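/- Let $p$ be a prime and let $L$ be a finite extension of $\mathbf{Q}_p$. Let $\mathbb{A}=\mathbf{R}\times\mathbb{A}_f$ be the ring of adeles of $\mathbf{Q}$ ($\mathbb{A}_f$ is the restricted product of the $\mathbf{Q}_\ell$ with respect to the $\mathbf{Z}_\ell$) and $\widehat{\mathbf{Z}}=\prod_\ell\mathbf{Z}_\ell$. For $H=\mathrm{GL}_2(\mathbb{A})$ or $H=\widehat{\mathbf{Z}}^{*}=\mathrm{GL}_1(\widehat{\mathbf{Z}})$, with their usual topologies, let $K_0\subset H$ be the subgroup of the elements whose components lie in $\mathrm{GL}_n(\mathbf{Z}_\ell)$ for all primes $\ell$ ($n=2$, resp. $n=1$) and that have trivial components at $p$ and (when $H=\mathrm{GL}_2(\mathbb{A})$) at infinity, and write $x_p$ for the $p$-component of $x\in H$. Consider the following $L$-vector spaces of functions $\phi:H\to L$: * $\mathcal{C}(H)$: continuous functions; * $\mathcal{C}^{(p)}(H)$: the $\phi\in\mathcal{C}(H)$ that are locally $K_0$-smooth, i.e. each $x\in H$ has a neighbourhood $U$ for which there is an open subgroup $K$ of $K_0$ with $\phi(y\kappa)=\phi(y)$ for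 all $y\in U$, $\kappa\in K$; * $\mathrm{LA}(H)$: the $\phi\in\mathcal{C}^{(p)}(H)$ that are locally analytic in $x_p$, i.e. near each point of $H$, $\phi$ is an analytic function (with values in $L$) of the entries of $x_p$; * $\mathrm{LP}(H)$: the $\phi\in\mathcal{C}^{(p)}(H)$ that are locally algebraic in $x_p$, i.e. near each point of $H$, $\phi$ is a polynomial with coefficients in $L$ in the entries of $x_p$ and in $\det(x_p)^{-1}$; * $\mathrm{LC}(H)$: locally constant functions. Let $X$ be any of $\mathcal{C},\mathcal{C}^{(p)},\mathrm{LA},\mathrm{LP},\mathrm{LC}$. The groups $\mathrm{GL}_2(\mathbf{Q})$ and $\mathrm{GL}_2(\mathbb{A})$ act on $X(\mathrm{GL}_2(\mathbb{A}))$ by $(\gamma*\phi)(x)=\phi(\gamma^{-1}x)$ and $(g\star\phi)(x)=\phi(xg)$; these actions commute, hence $\mathrm{GL}_2(\mathbb{A})$ acts on the cohomology groups $H^i(\mathrm{GL}_2(\mathbf{Q}),X(\mathrm{GL}_2(\mathbb{A})))$. Then: 1. There is a group homomorphism $c:\mathbb{A}^{*}\to\widehat{\mathbf{Z}}^{*}$,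 with kernel $\mathbf{R}_+^{*}\mathbf{Q}^{*}$, that is the identity on $\widehat{\mathbf{Z}}^{*}\subset\mathbb{A}^{*}$; in other words, the inclusion induces an isomorphism $\widehat{\mathbf{Z}}^{*}\cong\mathbb{A}^{*}/\mathbf{R}_+^{*}\mathbf{Q}^{*}$. For each $X$ there is an isomorphism of $L$-vector spaces $$H^0(\mathrm{GL}_2(\mathbf{Q}),X(\mathrm{GL}_2(\mathbb{A})))\cong X(\widehat{\mathbf{Z}}^{*})$$ that is $\mathrm{GL}_2(\mathbb{A})$-equivariant, where $g\in\mathrm{GL}_2(\mathbb{A})$ acts on $X(\widehat{\mathbf{Z}}^{*})$ through the determinant, by $(g\cdot f)(u)=f(u\,c(\det g))$. 2. $H^i(\mathrm{GL}_2(\mathbf{Q}),X(\mathrm{GL}_2(\mathbb{A})))=0$ for every $i\ge 2$ and each $X$. -/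

import Mathlib

open Topology Filter

noncomputable section

/-! ### Adeles of `ℚ` -/

instance primesFact (ℓ : Nat.Primes) : Fact (Nat.Prime ℓ) := ⟨ℓ.2⟩

/-- The finite adeles of `ℚ`: the restricted product of the `ℚ_ℓ` with respect to the `ℤ_ℓ`. -/
abbrev FinAdele : Type :=
  RestrictedProduct (fun ℓ : Nat.Primes => ℚ_[ℓ])
    (fun ℓ : Nat.Primes => (PadicInt.subring ℓ : Set ℚ_[ℓ])) cofinite

/-- The adele ring `𝔸 = ℝ × 𝔸_f` of `ℚ`, with its usual topology. -/
abbrev Adele : Type := ℝ × FinAdele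

/-- The profinite completion `Ẑ = ∏ ℤ_ℓ` of `ℤ`, with the product topology. -/
abbrev ZHat : Type := ∀ ℓ : Nat.Primes, ℤ_[ℓ]

instance padicIntOpenFact :
    Fact (∀ ℓ : Nat.Primes, IsOpen (PadicInt.subring ℓ : Set ℚ_[ℓ])) :=
  ⟨fun ℓ => by
    have h : (PadicInt.subring ℓ : Set ℚ_[ℓ]) = Metric.closedBall 0 1 := by
      ext x
      simp [PadicInt.subring]
    rw [h]
    exact IsUltrametricDist.isOpen_closedBall _ one_ne_zero⟩

theorem ratFinite (q : ℚ) :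
    ∀ᶠ ℓ : Nat.Primes in cofinite, ((q : ℚ) : ℚ_[ℓ]) ∈ (PadicInt.subring ℓ : Set ℚ_[ℓ]) := by
  have hfin : {ℓ : Nat.Primes | (ℓ : ℕ) ∣ q.den}.Finite := by
    refine Set.Finite.of_finite_image (f := fun ℓ : Nat.Primes => (ℓ : ℕ)) ?_
      (fun a _ b _ h => Subtype.ext h)
    refine (Set.finite_le_nat q.den).subset ?_
    rintro _ ⟨ℓ, hℓ, rfl⟩
    exact Nat.le_of_dvd q.den_pos hℓ
  refine mem_cofinite.2 (hfin.subset fun ℓ hℓ => ?_)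
  by_contra h
  exact hℓ (Padic.norm_rat_le_one h)

/-- The diagonal embedding of `ℚ` in the finite adeles. -/
def ratFinAdele : ℚ →+* FinAdele where
  toFun q := ⟨fun ℓ => (q : ℚ_[ℓ]), ratFinite q⟩
  map_one' := by ext ℓ; simp
  map_mul' a b := RestrictedProduct.ext _ _ fun ℓ => Rat.cast_mul a b
  map_zero' := by ext ℓ; simp
  map_add' a b := RestrictedProduct.ext _ _ fun ℓ => Rat.cast_add a b

/-- The diagonal embedding of `ℚ` in the adeles. -/
def ratAdele : ℚ →+* Adele := (algebraMap ℚ ℝ).prod ratFinAdele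

/-- The component `x ↦ x_∞`. -/
def compInfty : Adele →+* ℝ := RingHom.fst ℝ FinAdele

/-- The component `x ↦ x_ℓ`. -/
def compAt (ℓ : Nat.Primes) : Adele →+* ℚ_[ℓ] where
  toFun x := x.2 ℓ
  map_one' := rfl
  map_mul' _ _ := rfl
  map_zero' := rfl
  map_add' _ _ := rfl

/-- The inclusion `Ẑ → 𝔸` with component `1` at infinity (a morphism of monoids). -/
def zHatAdele : ZHat →* Adele where
  toFun u := (1, ⟨fun ℓ => (u ℓ : ℚ_[ℓ]), Eventually.of_forall fun ℓ => (u ℓ).2⟩)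
  map_one' := by
    refine Prod.ext rfl ?_
    ext ℓ
    simp
  map_mul' a b := by
    refine Prod.ext (by simp) ?_
    exact RestrictedProduct.ext _ _ fun ℓ => PadicInt.coe_mul (a ℓ) (b ℓ)

/-- The inclusion of `Ẑ^*` in the group of ideles `𝔸^*`. -/
def zHatUnits : ZHatˣ →* Adeleˣ := Units.map zHatAdele

/-- The subgroup `ℚ^*` of the group of ideles. -/
def ratIdeles : Subgroup Adeleˣ := (Units.map (ratAdele : ℚ →* Adele)).range

/-- The subgroup `ℝ_+^*` of the group of ideles. -/
def realPosIdeles : Subgroup Adeleˣ where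
  carrier := {a | 0 < (a : Adele).1 ∧ (a : Adele).2 = 1}
  one_mem' := ⟨one_pos, rfl⟩
  mul_mem' {a b} ha hb := ⟨mul_pos ha.1 hb.1, by
    rw [Units.val_mul, Prod.snd_mul, ha.2, hb.2, one_mul]⟩
  inv_mem' {a} ha := by
    have h1 : (a : Adele).1 * ((a⁻¹ : Adeleˣ) : Adele).1 = 1 := congrArg Prod.fst a.mul_inv
    have h2 : (a : Adele).2 * ((a⁻¹ : Adeleˣ) : Adele).2 = 1 := congrArg Prod.snd a.mul_inv
    refine ⟨?_, ?_⟩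
    · exact (pos_iff_pos_of_mul_pos (h1 ▸ one_pos)).1 ha.1
    · rwa [ha.2, one_mul] at h2

/-! ### Classes of functions

`H` is a topological group (below, `GL_2(𝔸)` or `Ẑ^*`), `K₀` is the subgroup of `H` that consists
of the integral elements with trivial components at `p` and at infinity, and `π` is the
component at `p`, written as an element of `GL_n(ℚ_p)`. -/

section FunctionSpaces

variable {H : Type} [Group H] [TopologicalSpace H] {n : Type} [Fintype n] [DecidableEq n]
  (p : Nat.Primes) (L : Type) [NormedField L] [NormedAlgebra ℚ_[p] L]

/-- `φ` is locally smooth for the action of `K₀` by right translations: near each point, it is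
invariant by an open subgroup of `K₀`. -/
def IsLocSmooth {L : Type} (K₀ : Subgroup H) (φ : H → L) : Prop :=
  ∀ x, ∃ U ∈ 𝓝 x, ∃ K : Subgroup K₀, IsOpen (K : Set K₀) ∧
    ∀ y ∈ U, ∀ κ ∈ K, φ (y * (κ : H)) = φ y

/-- `φ` is locally an analytic function of the entries of the component at `p`. -/
def IsLocAnalyticAt (π : H →* GL n ℚ_[p]) (φ : H → L) : Prop :=
  ∀ x, ∃ F : (n → n → ℚ_[p]) → L, AnalyticAt ℚ_[p] F (fun i j => π x i j) ∧
    ∀ᶠ y in 𝓝 x, φ y = F (fun i j => π y i j)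

/-- The algebraic functions on `GL_n(ℚ_p)` with values in `L`: the `L`-algebra generated by the
entries and by the inverse of the determinant. -/
def algFun (n : Type) [Fintype n] [DecidableEq n] : Subalgebra L (GL n ℚ_[p] → L) :=
  Algebra.adjoin L
    (Set.range (fun (ij : n × n) (g : GL n ℚ_[p]) => algebraMap ℚ_[p] L (g ij.1 ij.2)) ∪
      {fun (g : GL n ℚ_[p]) => algebraMap ℚ_[p] L ((g : Matrix n n ℚ_[p]).det)⁻¹})

/-- `φ` is locally an algebraic function of the component at `p`. -/
def IsLocAlgebraicAt (π : H →* GL n ℚ_[p]) (φ : H → L) : Prop :=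
  ∀ x, ∃ P ∈ algFun p L n, ∀ᶠ y in 𝓝 x, φ y = P (π y)

/-- The five classes of functions. -/
inductive FunClass : Type
  /-- `𝒞`: continuous functions. -/
  | cont
  /-- `𝒞^(p)`: continuous functions that are locally smooth outside `p`. -/
  | contSmooth
  /-- `LA`: functions in `𝒞^(p)` that are locally analytic in `x_p`. -/
  | locAn
  /-- `LP`: functions in `𝒞^(p)` that are locally algebraic in `x_p`. -/
  | locAlg
  /-- `LC`: locally constant functions. -/
  | locConst

/-- Membership of `φ : H → L` in the class `X`. -/
def FunClass.Mem (K₀ : Subgroup H) (π : H →* GL n ℚ_[p]) (φ : H → L) : FunClass → Prop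
  | .cont => Continuous φ
  | .contSmooth => Continuous φ ∧ IsLocSmooth K₀ φ
  | .locAn => (Continuous φ ∧ IsLocSmooth K₀ φ) ∧ IsLocAnalyticAt p L π φ
  | .locAlg => (Continuous φ ∧ IsLocSmooth K₀ φ) ∧ IsLocAlgebraicAt p L π φ
  | .locConst => IsLocallyConstant φ

variable {p L}

theorem IsLocSmooth.add {K₀ : Subgroup H} {φ ψ : H → L} (hφ : IsLocSmooth K₀ φ)
    (hψ : IsLocSmooth K₀ ψ) : IsLocSmooth K₀ (φ + ψ) := by
  intro x
  obtain ⟨U, hU, K, hK, h⟩ := hφ x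
  obtain ⟨U', hU', K', hK', h'⟩ := hψ x
  refine ⟨U ∩ U', inter_mem hU hU', K ⊓ K', hK.inter hK', fun y hy κ hκ => ?_⟩
  simp [h y hy.1 κ hκ.1, h' y hy.2 κ hκ.2]

theorem IsLocSmooth.smul {K₀ : Subgroup H} {φ : H → L} (c : L) (hφ : IsLocSmooth K₀ φ) :
    IsLocSmooth K₀ (c • φ) := by
  intro x
  obtain ⟨U, hU, K, hK, h⟩ := hφ x
  exact ⟨U, hU, K, hK, fun y hy κ hκ => by simp [h y hy κ hκ]⟩

theorem IsLocSmooth.zero {K₀ : Subgroup H} : IsLocSmooth K₀ (0 : H → L) :=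
  fun _ => ⟨Set.univ, univ_mem, ⊤, isOpen_univ, fun _ _ _ _ => rfl⟩

theorem IsLocAnalyticAt.add {π : H →* GL n ℚ_[p]} {φ ψ : H → L} (hφ : IsLocAnalyticAt p L π φ)
    (hψ : IsLocAnalyticAt p L π ψ) : IsLocAnalyticAt p L π (φ + ψ) := by
  intro x
  obtain ⟨F, hF, h⟩ := hφ x
  obtain ⟨F', hF', h'⟩ := hψ x
  refine ⟨F + F', hF.add hF', ?_⟩
  filter_upwards [h, h'] with y hy hy'
  simp [hy, hy']

theorem IsLocAnalyticAt.smul {π : H →* GL n ℚ_[p]} {φ : H → L} (c : L)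
    (hφ : IsLocAnalyticAt p L π φ) : IsLocAnalyticAt p L π (c • φ) := by
  intro x
  obtain ⟨F, hF, h⟩ := hφ x
  refine ⟨c • F, ?_, ?_⟩
  · exact (analyticAt_const (𝕜 := ℚ_[p]) (v := c)).smul hF
  · filter_upwards [h] with y hy
    simp [hy]

theorem IsLocAnalyticAt.zero {π : H →* GL n ℚ_[p]} : IsLocAnalyticAt p L π (0 : H → L) :=
  fun _ => ⟨0, analyticAt_const, Eventually.of_forall fun _ => rfl⟩

theorem IsLocAlgebraicAt.add {π : H →* GL n ℚ_[p]} {φ ψ : H → L}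
    (hφ : IsLocAlgebraicAt p L π φ) (hψ : IsLocAlgebraicAt p L π ψ) :
    IsLocAlgebraicAt p L π (φ + ψ) := by
  intro x
  obtain ⟨F, hF, h⟩ := hφ x
  obtain ⟨F', hF', h'⟩ := hψ x
  refine ⟨F + F', add_mem hF hF', ?_⟩
  filter_upwards [h, h'] with y hy hy'
  simp [hy, hy']

theorem IsLocAlgebraicAt.smul {π : H →* GL n ℚ_[p]} {φ : H → L} (c : L)
    (hφ : IsLocAlgebraicAt p L π φ) : IsLocAlgebraicAt p L π (c • φ) := by
  intro x
  obtain ⟨F, hF, h⟩ := hφ x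
  refine ⟨c • F, Subalgebra.smul_mem _ hF c, ?_⟩
  filter_upwards [h] with y hy
  simp [hy]

theorem IsLocAlgebraicAt.zero {π : H →* GL n ℚ_[p]} : IsLocAlgebraicAt p L π (0 : H → L) :=
  fun _ => ⟨0, zero_mem _, Eventually.of_forall fun _ => rfl⟩

variable (p L)

/-- The `L`-vector space of the functions `H → L` in the class `X`. -/
def funSpace (K₀ : Subgroup H) (π : H →* GL n ℚ_[p]) (X : FunClass) : Submodule L (H → L) where
  carrier := {φ | X.Mem p L K₀ π φ}
  add_mem' {φ ψ} hφ hψ := by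
    cases X
    · exact Continuous.add hφ hψ
    · exact ⟨hφ.1.add hψ.1, hφ.2.add hψ.2⟩
    · exact ⟨⟨hφ.1.1.add hψ.1.1, hφ.1.2.add hψ.1.2⟩, hφ.2.add hψ.2⟩
    · exact ⟨⟨hφ.1.1.add hψ.1.1, hφ.1.2.add hψ.1.2⟩, hφ.2.add hψ.2⟩
    · exact IsLocallyConstant.add hφ hψ
  zero_mem' := by
    cases X
    · exact continuous_zero
    · exact ⟨continuous_zero, IsLocSmooth.zero⟩
    · exact ⟨⟨continuous_zero, IsLocSmooth.zero⟩, IsLocAnalyticAt.zero⟩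
    · exact ⟨⟨continuous_zero, IsLocSmooth.zero⟩, IsLocAlgebraicAt.zero⟩
    · exact IsLocallyConstant.const 0
  smul_mem' c φ hφ := by
    cases X
    · exact Continuous.const_smul hφ c
    · exact ⟨hφ.1.const_smul c, hφ.2.smul c⟩
    · exact ⟨⟨hφ.1.1.const_smul c, hφ.1.2.smul c⟩, hφ.2.smul c⟩
    · exact ⟨⟨hφ.1.1.const_smul c, hφ.1.2.smul c⟩, hφ.2.smul c⟩
    · exact IsLocallyConstant.comp hφ (fun z => c • z)

/-! #### Stability under left and right translations -/

variable {p L}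

theorem isLocSmooth_translate [IsTopologicalGroup H] {K₀ : Subgroup H}
    (hK₀ : ∀ b : H, ∀ᶠ κ in 𝓝 (1 : H), κ ∈ K₀ → b⁻¹ * κ * b ∈ K₀) {φ : H → L}
    (hφ : IsLocSmooth K₀ φ) (a b : H) : IsLocSmooth K₀ (fun x => φ (a * x * b)) := by
  intro x
  obtain ⟨U, hU, K, hK, h⟩ := hφ (a * x * b)
  have hc : Continuous fun y : H => a * y * b := by fun_prop
  let M : Subgroup K₀ := ((K.map K₀.subtype).comap (MulAut.conj b⁻¹).toMonoidHom).comap K₀.subtype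
  have hM : ∀ κ : K₀, κ ∈ M ↔ ∃ k ∈ K, (k : H) = b⁻¹ * κ * b := by
    intro κ
    change (MulAut.conj b⁻¹) (κ : H) ∈ K.map K₀.subtype ↔ _
    rw [Subgroup.mem_map, MulAut.conj_apply, inv_inv]
    rfl
  refine ⟨_, hc.continuousAt hU, M, ?_, fun y hy κ hκ => ?_⟩
  · refine Subgroup.isOpen_of_mem_nhds M (g := 1) ?_
    have hK1 := hK.mem_nhds (one_mem K)
    rw [nhds_induced] at hK1 ⊢
    obtain ⟨V, hV, hVK⟩ := hK1
    have hc' : Tendsto (fun κ : H => b⁻¹ * κ * b) (𝓝 1) (𝓝 1) := by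
      have : Continuous fun κ : H => b⁻¹ * κ * b := by fun_prop
      simpa using this.tendsto 1
    refine ⟨_, inter_mem (hc' hV) (hK₀ b), fun κ hκ => ?_⟩
    have h2 : b⁻¹ * (κ : H) * b ∈ K₀ := hκ.2 κ.2
    exact (hM κ).2 ⟨⟨_, h2⟩, hVK hκ.1, rfl⟩
  · obtain ⟨k, hk, hkκ⟩ := (hM κ).1 hκ
    have h3 : φ (a * y * b * k) = φ (a * y * b) := h _ hy k hk
    change φ (a * (y * κ) * b) = φ (a * y * b)
    rw [← h3, hkκ]
    congr 1
    group

theorem isLocAnalyticAt_translate [IsTopologicalGroup H] {π : H →* GL n ℚ_[p]} {φ : H → L}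
    (hφ : IsLocAnalyticAt p L π φ) (a b : H) :
    IsLocAnalyticAt p L π (fun x => φ (a * x * b)) := by
  intro x
  obtain ⟨F, hF, h⟩ := hφ (a * x * b)
  have hc : Continuous fun y : H => a * y * b := by fun_prop
  let e : Matrix n n ℚ_[p] ≃ₗ[ℚ_[p]] (n → n → ℚ_[p]) := (Matrix.ofLinearEquiv ℚ_[p]).symm
  let T : (n → n → ℚ_[p]) →ₗ[ℚ_[p]] (n → n → ℚ_[p]) :=
    e.toLinearMap ∘ₗ LinearMap.mulRight ℚ_[p] (π b : Matrix n n ℚ_[p]) ∘ₗ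
      LinearMap.mulLeft ℚ_[p] (π a : Matrix n n ℚ_[p]) ∘ₗ e.symm.toLinearMap
  have hT : ∀ y : H, T (fun i j => π y i j) = fun i j => π (a * y * b) i j := by
    intro y
    rw [map_mul, map_mul]
    rfl
  refine ⟨F ∘ T, ?_, ?_⟩
  · refine AnalyticAt.comp (by rwa [hT]) ?_
    exact (LinearMap.toContinuousLinearMap T).analyticAt _
  · filter_upwards [hc.continuousAt h] with y hy
    rw [Function.comp_apply, hT]
    exact hy

theorem algFun_translate {P : GL n ℚ_[p] → L} (hP : P ∈ algFun p L n) (a b : GL n ℚ_[p]) :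
    (fun g => P (a * g * b)) ∈ algFun p L n := by
  unfold algFun at hP
  induction hP using Algebra.adjoin_induction with
  | mem P hP =>
    rcases hP with ⟨⟨i, j⟩, rfl⟩ | rfl
    · have : (fun g : GL n ℚ_[p] => algebraMap ℚ_[p] L ((a * g * b) i j)) =
          ∑ k, ∑ l, (algebraMap ℚ_[p] L (a i l) * algebraMap ℚ_[p] L (b k j)) •
            (fun g : GL n ℚ_[p] => algebraMap ℚ_[p] L (g l k)) := by
        funext g
        simp [Matrix.mul_apply, Finset.sum_apply, Finset.sum_mul]
        refine Finset.sum_congr rfl fun k _ => Finset.sum_congr rfl fun l _ => ?_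
        ring
      change (fun g : GL n ℚ_[p] => algebraMap ℚ_[p] L ((a * g * b) i j)) ∈ _
      rw [this]
      refine sum_mem fun k _ => sum_mem fun l _ => Subalgebra.smul_mem _ ?_ _
      exact Algebra.subset_adjoin (Or.inl ⟨(l, k), rfl⟩)
    · have : (fun g : GL n ℚ_[p] =>
          algebraMap ℚ_[p] L (((a * g * b : GL n ℚ_[p]) : Matrix n n ℚ_[p]).det)⁻¹) =
          (algebraMap ℚ_[p] L ((a : Matrix n n ℚ_[p]).det)⁻¹ *
            algebraMap ℚ_[p] L ((b : Matrix n n ℚ_[p]).det)⁻¹) •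
            (fun g : GL n ℚ_[p] => algebraMap ℚ_[p] L ((g : Matrix n n ℚ_[p]).det)⁻¹) := by
        funext g
        simp [Matrix.det_mul]
        ring
      rw [this]
      refine Subalgebra.smul_mem _ ?_ _
      exact Algebra.subset_adjoin (Or.inr rfl)
  | algebraMap r => exact Subalgebra.algebraMap_mem _ r
  | add P Q _ _ hP hQ => exact add_mem hP hQ
  | mul P Q _ _ hP hQ => exact mul_mem hP hQ

theorem isLocAlgebraicAt_translate [IsTopologicalGroup H] {π : H →* GL n ℚ_[p]} {φ : H → L}
    (hφ : IsLocAlgebraicAt p L π φ) (a b : H) :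
    IsLocAlgebraicAt p L π (fun x => φ (a * x * b)) := by
  intro x
  obtain ⟨P, hP, h⟩ := hφ (a * x * b)
  have hc : Continuous fun y : H => a * y * b := by fun_prop
  refine ⟨_, algFun_translate hP (π a) (π b), ?_⟩
  filter_upwards [hc.continuousAt h] with y hy
  rw [← map_mul, ← map_mul]
  exact hy

theorem funSpace_translate [IsTopologicalGroup H] {K₀ : Subgroup H} {π : H →* GL n ℚ_[p]}
    (hK₀ : ∀ b : H, ∀ᶠ κ in 𝓝 (1 : H), κ ∈ K₀ → b⁻¹ * κ * b ∈ K₀) {X : FunClass} {φ : H → L}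
    (hφ : φ ∈ funSpace p L K₀ π X) (a b : H) :
    (fun x => φ (a * x * b)) ∈ funSpace p L K₀ π X := by
  have hc : Continuous fun y : H => a * y * b := by fun_prop
  cases X
  · exact Continuous.comp hφ hc
  · exact ⟨hφ.1.comp hc, isLocSmooth_translate hK₀ hφ.2 a b⟩
  · exact ⟨⟨hφ.1.1.comp hc, isLocSmooth_translate hK₀ hφ.1.2 a b⟩,
      isLocAnalyticAt_translate hφ.2 a b⟩
  · exact ⟨⟨hφ.1.1.comp hc, isLocSmooth_translate hK₀ hφ.1.2 a b⟩,
      isLocAlgebraicAt_translate hφ.2 a b⟩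
  · exact IsLocallyConstant.comp_continuous hφ hc

end FunctionSpaces

/-! ### The functions on `GL_2(𝔸)` and on `Ẑ^*` -/

/-- The group `GL_2(ℚ)`. -/
abbrev GLQ : Type := GL (Fin 2) ℚ

/-- The topological group `GL_2(𝔸)`. -/
abbrev GLA : Type := GL (Fin 2) Adele

/-- The diagonal embedding of `GL_2(ℚ)` in `GL_2(𝔸)`. -/
def ratGL : GLQ →* GLA := Matrix.GeneralLinearGroup.map ratAdele

/-- The component at `ℓ` of an element of `GL_2(𝔸)`. -/
def compGL (ℓ : Nat.Primes) : GLA →* GL (Fin 2) ℚ_[ℓ] := Matrix.GeneralLinearGroup.map (compAt ℓ)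

/-- The subgroup of the elements of `GL_2(𝔸)` that are trivial at infinity and at `p`, and belong
to `GL_2(ℤ_ℓ)` for all `ℓ`. -/
def integralAwayGL (p : Nat.Primes) : Subgroup GLA :=
  (Matrix.GeneralLinearGroup.map (n := Fin 2) compInfty).ker ⊓ (compGL p).ker ⊓
    ⨅ ℓ : Nat.Primes,
      (Matrix.GeneralLinearGroup.map (n := Fin 2) (PadicInt.Coe.ringHom (p := ℓ))).range.comap
        (compGL ℓ)

theorem mem_range_padicInt {ℓ : Nat.Primes} (g : GL (Fin 2) ℚ_[ℓ])
    (h : ∀ i j, g i j ∈ PadicInt.subring ℓ) (h' : ∀ i j, g⁻¹ i j ∈ PadicInt.subring ℓ) :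
    g ∈ (Matrix.GeneralLinearGroup.map (n := Fin 2) (PadicInt.Coe.ringHom (p := ℓ))).range := by
  let A : Matrix (Fin 2) (Fin 2) ℤ_[ℓ] := Matrix.of fun i j => ⟨g i j, h i j⟩
  let B : Matrix (Fin 2) (Fin 2) ℤ_[ℓ] := Matrix.of fun i j => ⟨g⁻¹ i j, h' i j⟩
  have hinj : Function.Injective (PadicInt.Coe.ringHom (p := ℓ)) := Subtype.val_injective
  have hA : (PadicInt.Coe.ringHom (p := ℓ)).mapMatrix A = g := rfl
  have hB : (PadicInt.Coe.ringHom (p := ℓ)).mapMatrix B = (g⁻¹ : GL (Fin 2) ℚ_[ℓ]) := rfl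
  have hm : Function.Injective ((PadicInt.Coe.ringHom (p := ℓ)).mapMatrix (m := Fin 2)) :=
    Matrix.map_injective hinj
  refine ⟨⟨A, B, hm ?_, hm ?_⟩, ?_⟩
  · rw [map_mul, hA, hB, map_one, Units.mul_inv]
  · rw [map_mul, hA, hB, map_one, Units.inv_mul]
  · exact Units.ext hA

theorem integralAwayGL_conj (p : Nat.Primes) (b : GLA) :
    ∀ᶠ κ in 𝓝 (1 : GLA), κ ∈ integralAwayGL p → b⁻¹ * κ * b ∈ integralAwayGL p := by
  let O : Set FinAdele := {x | ∀ ℓ : Nat.Primes, x ℓ ∈ (PadicInt.subring ℓ : Set ℚ_[ℓ])}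
  have hO : IsOpen O := RestrictedProduct.isOpen_forall_mem padicIntOpenFact.out
  have h1 : ∀ i j, ((1 : GLA) i j).2 ∈ O := by
    intro i j (ℓ : Nat.Primes)
    by_cases hij : i = j
    · subst hij
      simpa using one_mem (PadicInt.subring ℓ)
    · simpa [Matrix.one_apply_ne hij] using zero_mem (PadicInt.subring ℓ)
  have hent : ∀ i j, Continuous fun g : GLA => (g i j).2 := fun i j =>
    by
    have h : Continuous fun g : GLA => (g : Matrix (Fin 2) (Fin 2) Adele) := Units.continuous_val
    exact continuous_snd.comp (h.matrix_elem i j)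
  have hc : Continuous fun κ : GLA => b⁻¹ * κ * b := by fun_prop
  have hc2 : Continuous fun κ : GLA => (b⁻¹ * κ * b)⁻¹ := hc.inv
  have hc1 : b⁻¹ * 1 * b = 1 := by group
  have e1 : ∀ i j, ∀ᶠ κ in 𝓝 (1 : GLA), ((b⁻¹ * κ * b) i j).2 ∈ O := fun i j =>
    ((hent i j).comp hc).continuousAt.eventually (hO.mem_nhds (by
      rw [Function.comp_apply, hc1]
      exact h1 i j))
  have e2 : ∀ i j, ∀ᶠ κ in 𝓝 (1 : GLA), ((b⁻¹ * κ * b)⁻¹ i j).2 ∈ O := fun i j =>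
    ((hent i j).comp hc2).continuousAt.eventually (hO.mem_nhds (by
      rw [Function.comp_apply, hc1, inv_one]
      exact h1 i j))
  filter_upwards [eventually_all.2 fun i => eventually_all.2 (e1 i),
    eventually_all.2 fun i => eventually_all.2 (e2 i)] with κ k1 k2 hκ
  refine ⟨⟨?_, ?_⟩, ?_⟩
  · simpa using Subgroup.Normal.conj_mem inferInstance κ hκ.1.1 b⁻¹
  · simpa using Subgroup.Normal.conj_mem inferInstance κ hκ.1.2 b⁻¹
  · refine Subgroup.mem_iInf.2 fun ℓ => ?_
    refine mem_range_padicInt _ (fun i j => k1 i j ℓ) (fun i j => ?_)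
    rw [← map_inv]
    exact k2 i j ℓ

section Adelic

variable (p : Nat.Primes) (L : Type) [NormedField L] [NormedAlgebra ℚ_[p] L]

/-- The space `X(GL_2(𝔸))`. -/
def adelicSpace (X : FunClass) : Submodule L (GLA → L) :=
  funSpace p L (integralAwayGL p) (compGL p) X

/-- The subgroup of the elements of `Ẑ^*` that are trivial at `p`. -/
def unitsAway : Subgroup ZHatˣ := (Units.map (Pi.evalMonoidHom (fun ℓ : Nat.Primes => ℤ_[ℓ]) p)).ker

/-- The component at `p` of an element of `Ẑ^*`, as an element of `GL_1(ℚ_p)`. -/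
def compUnits : ZHatˣ →* GL (Fin 1) ℚ_[p] :=
  Units.map ((Matrix.scalar (Fin 1) : ℚ_[p] →+* Matrix (Fin 1) (Fin 1) ℚ_[p]).comp
    ((PadicInt.Coe.ringHom (p := p)).comp (Pi.evalRingHom (fun ℓ : Nat.Primes => ℤ_[ℓ]) p)) :
      ZHat →* Matrix (Fin 1) (Fin 1) ℚ_[p])

/-- The space `X(Ẑ^*)`. -/
def unitsSpace (X : FunClass) : Submodule L (ZHatˣ → L) :=
  funSpace p L (unitsAway p) (compUnits p) X

/-- The action `(γ * φ)(x) = φ(γ⁻¹ x)` of `GL_2(ℚ)` on `X(GL_2(𝔸))`. -/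
def adelicRho (X : FunClass) : Representation L GLQ (adelicSpace p L X) where
  toFun γ :=
    { toFun := fun φ => ⟨fun x => (φ : GLA → L) ((ratGL γ)⁻¹ * x), by
        have h := funSpace_translate (integralAwayGL_conj p) φ.2 (ratGL γ)⁻¹ 1
        simp only [mul_one] at h
        exact h⟩
      map_add' := fun _ _ => rfl
      map_smul' := fun _ _ => rfl }
  map_one' := by
    ext φ x
    simp
  map_mul' γ γ' := by
    ext φ x
    simp [mul_assoc]

/-- `X(GL_2(𝔸))` as a representation of `GL_2(ℚ)`. -/
abbrev adelicRep (X : FunClass) : Rep L GLQ := Rep.of (adelicRho p L X)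

/-- The action `(g ⋆ φ)(x) = φ(x g)` of `g ∈ GL_2(𝔸)` on `X(GL_2(𝔸))`, which commutes with the
action of `GL_2(ℚ)`. -/
def rightTranslation (X : FunClass) (g : GLA) : adelicRep p L X ⟶ adelicRep p L X :=
  Rep.ofHom
    { toFun := fun φ => ⟨fun x => (φ : GLA → L) (x * g), by
        have h := funSpace_translate (integralAwayGL_conj p) φ.2 1 g
        simp only [one_mul] at h
        exact h⟩
      map_add' := fun _ _ => rfl
      map_smul' := fun _ _ => rfl
      isIntertwining' := fun γ => by
        ext φ x
        simp [adelicRho, mul_assoc] }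

/-- `H^i(GL_2(ℚ), X(GL_2(𝔸)))`. -/
abbrev adelicCohomology (X : FunClass) (i : ℕ) : ModuleCat L :=
  groupCohomology (adelicRep p L X) i

/-- The action of `g ∈ GL_2(𝔸)` on `H^i(GL_2(ℚ), X(GL_2(𝔸)))`. -/
def adelicAction (X : FunClass) (i : ℕ) (g : GLA) :
    adelicCohomology p L X i ⟶ adelicCohomology p L X i :=
  groupCohomology.map (MonoidHom.id GLQ) (rightTranslation p L X g) i

end Adelic

end

noncomputable section

/-! ### Vanishing of the cohomology of virtually free groups -/

section Cohomology

open CategoryTheory CategoryTheory.Limits groupCohomology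

variable {k G : Type} [CommRing k] [Group G]

/-! Degree zero. Let `φ` be a continuous left `GL_2(ℚ)`-invariant function on `GL_2(𝔸)` with values
in a totally disconnected T1 space. Its left periods form a closed subgroup that contains `GL_2(ℚ)`
and, as `ℝ` is connected, every continuous real path through 1: the real unipotents and the positive
real diagonal matrices in particular. Since `ℚ + ℝ` is dense in `𝔸` (`addSubgroup_adele_eq_top`),
all adelic unipotents are periods. The adeles have stable rank one (`exists_isUnit_add_mul`), so
these generate `SL_2(𝔸)`, and `φ` depends only on the determinant modulo `ℝ_+^* ℚ^*`, that is, on an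
element of `Ẑ^*` (`eq_diagGL_ideleProj_det`). The section `u ↦ (u 0; 0 1)` turns `φ` into a function
on `Ẑ^*`. The five classes correspond because, near each point, the `p`-component of `c (det x)` is
a constant multiple of `det x_p` (`eventually_compUnits_detProj`).

Degrees at least two. Applied to a `Bool`-valued indicator, the same argument gives strong
approximation: `GL_2(𝔸) = GL_2(ℚ) U` with `U = GL_2(ℝ)_+ × GL_2(Ẑ)` open and `GL_2(ℚ) ∩ U =
SL_2(ℤ)`. All the classes are local, so functions can be glued from the translates of `U`, and this
makes `X(GL_2(𝔸))` a direct factor of a representation coinduced from `SL_2(ℤ)`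
(`coindUnit_comp_glueHom`). By Shapiro's lemma it remains to treat `SL_2(ℤ)`. It has a free subgroup
of finite index (`lift_sanovGen_injective`, `range_lift_sanovGen_finiteIndex`). In characteristic
zero averaging over cosets passes to that subgroup, and a free group has cohomological dimension at
most one (`isZero_groupCohomology_of_isFreeGroup`). -/

theorem isZero_groupCohomology_of_retract {A B : Rep k G} (i : A ⟶ B) (r : B ⟶ A)
    (h : i ≫ r = 𝟙 A) {n : ℕ} (hB : IsZero (groupCohomology B n)) :
    IsZero (groupCohomology A n) := by
  have h1 : groupCohomology.map (MonoidHom.id G) i n ≫ groupCohomology.map (MonoidHom.id G) r n = 𝟙 _ := by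
    rw [← groupCohomology.map_id_comp, h, groupCohomology.map_id]
  rw [IsZero.iff_id_eq_zero, ← h1, hB.eq_of_tgt (groupCohomology.map (MonoidHom.id G) i n) 0, zero_comp]

theorem isZero_groupCohomology_coind_bot (A : Rep k (⊥ : Subgroup G)) (n : ℕ) :
    IsZero (groupCohomology (Rep.coind (⊥ : Subgroup G).subtype A) (n + 1)) :=
  (isZero_groupCohomology_succ_of_subsingleton A n).of_iso (coindIso A (n + 1))

/-- The embedding of a representation in the representation coinduced from its restriction. -/
def coindUnit (S : Subgroup G) (A : Rep k G) :
    A ⟶ Rep.coind S.subtype (Rep.res S.subtype A) :=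
  Rep.resCoindToHom S.subtype A (Rep.res S.subtype A) (𝟙 _)

theorem coindUnit_apply (S : Subgroup G) (A : Rep k G) (a : A) (g : G) :
    ((coindUnit S A).hom a).1 g = A.ρ g a := rfl

theorem mono_coindUnit (S : Subgroup G) (A : Rep k G) : Mono (coindUnit S A) := by
  rw [Rep.mono_iff_injective]
  intro a b hab
  have h := congrFun (congrArg Subtype.val hab) 1
  rw [coindUnit_apply, coindUnit_apply, map_one] at h
  exact h

/-- A cocycle of a free group lifts along a surjection of representations. -/
theorem exists_cocycle_lift [IsFreeGroup G] {A B : Rep k G} (f : A ⟶ B)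
    (hf : Function.Surjective f.hom) (z : cocycles₁ B) :
    ∃ y : cocycles₁ A, ∀ g, f.hom (y g) = z g := by
  choose s hs using hf
  -- A cocycle `y` is the same as an action by the affine maps `a ↦ g a + y(g)`. On a free group
  -- such an action can be prescribed on the generators, with translation parts any lifts of the
  -- values of `z`.
  let e : IsFreeGroup.Generators G → Equiv.Perm A := fun x =>
    { toFun := fun a => A.ρ (IsFreeGroup.of x) a + s (z (IsFreeGroup.of x))
      invFun := fun a => A.ρ (IsFreeGroup.of x)⁻¹ (a - s (z (IsFreeGroup.of x)))
      left_inv := fun a => by simp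
      right_inv := fun a => by simp }
  let Φ : G →* Equiv.Perm A := IsFreeGroup.lift e
  -- The elements that act by an affine map with linear part `ρ(g)` and with translation part above
  -- `z(g)`. They form a subgroup that contains the generators.
  let N : Subgroup G :=
    { carrier := {g | (∀ a, Φ g a = A.ρ g a + Φ g 0) ∧ f.hom (Φ g 0) = z g}
      one_mem' := by simp
      mul_mem' := by
        rintro g h ⟨hg, hg'⟩ ⟨hh, hh'⟩
        refine ⟨fun a => ?_, ?_⟩
        · rw [map_mul, Equiv.Perm.mul_apply, Equiv.Perm.mul_apply, hg, hg (Φ h 0), hh]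
          simp [add_assoc]
        · rw [map_mul, Equiv.Perm.mul_apply, hg, map_add, Rep.hom_comm_apply, hh', hg']
          exact ((mem_cocycles₁_iff _).1 z.2 g h).symm
      inv_mem' := by
        rintro g ⟨hg, hg'⟩
        have h0 : ∀ a, Φ g⁻¹ a = A.ρ g⁻¹ (a - Φ g 0) := fun a => by
          rw [map_inv, Equiv.Perm.inv_eq_iff_eq, hg]
          simp
        refine ⟨fun a => ?_, ?_⟩
        · rw [h0, h0, ← map_add]
          simp [sub_eq_add_neg]
        · rw [h0, Rep.hom_comm_apply, zero_sub, map_neg, hg']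
          rw [← cocycles₁_map_inv, Representation.inv_self_apply] }
  have hN : ∀ g, g ∈ N := by
    intro g
    obtain ⟨w, rfl⟩ := (IsFreeGroup.basis G).repr.symm.surjective g
    have hof : ∀ x, (IsFreeGroup.basis G).repr.symm (FreeGroup.of x) ∈ N := fun x => by
      have h1 : ∀ a, Φ (IsFreeGroup.of x) a =
          A.ρ (IsFreeGroup.of x) a + s (z (IsFreeGroup.of x)) := fun a => by
        rw [show Φ (IsFreeGroup.of x) = e x from IsFreeGroup.lift_of e x]
        rfl
      refine ⟨fun a => ?_, ?_⟩
      · refine (h1 a).trans (congrArg (A.ρ (IsFreeGroup.of x) a + ·) ?_)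
        exact ((h1 0).trans (by simp)).symm
      · exact (congrArg f.hom (h1 0)).trans (by simp [hs]; rfl)
    induction w using FreeGroup.induction_on with
    | C1 => rw [map_one]; exact N.one_mem
    | of x => exact hof x
    | inv_of x _ => rw [map_inv]; exact N.inv_mem (hof x)
    | mul x y hx hy => rw [map_mul]; exact N.mul_mem hx hy
  refine ⟨⟨fun g => Φ g 0, ?_⟩, fun g => (hN g).2⟩
  rw [mem_cocycles₁_iff]
  intro g h
  rw [map_mul, Equiv.Perm.mul_apply, (hN g).1]

/-- For a free group `H^1` is right exact: a cocycle of `B` lifts to `A`, where it is a coboundary,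
and `f` carries coboundaries to coboundaries. -/
theorem isZero_groupCohomology_one_of_epi [IsFreeGroup G] {A B : Rep k G} (f : A ⟶ B) [Epi f]
    (hA : IsZero (groupCohomology A 1)) : IsZero (groupCohomology B 1) := by
  rw [ModuleCat.isZero_iff_subsingleton] at hA ⊢
  have key : ∀ x : H1 B, x = 0 := fun x => by
    induction x using H1_induction_on with | _ z
    obtain ⟨y, hy⟩ := exists_cocycle_lift f ((Rep.epi_iff_surjective f).1 inferInstance) z
    obtain ⟨a, ha⟩ := (H1π_eq_zero_iff y).1 (hA.elim (H1π A y) 0)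
    refine (H1π_eq_zero_iff z).2 ⟨f.hom a, funext fun g => ?_⟩
    rw [← hy, ← congrFun ha g]
    simp [Rep.hom_comm_apply]
  exact ⟨fun x y => (key x).trans (key y).symm⟩

/-- Dimension shifting along the embedding of `A` in the representation coinduced from the trivial
subgroup, which is acyclic by Shapiro's lemma. The induction starts with `H^1` of the cokernel, a
quotient of an acyclic representation. -/
theorem isZero_groupCohomology_of_isFreeGroup [IsFreeGroup G] (A : Rep k G) (n : ℕ) :
    IsZero (groupCohomology A (n + 2)) := by
  have := mono_coindUnit ⊥ A
  have hX : (ShortComplex.mk (coindUnit ⊥ A) (cokernel.π (coindUnit ⊥ A))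
      (cokernel.condition _)).ShortExact :=
    { exact := ShortComplex.exact_cokernel _ }
  have hW := isZero_groupCohomology_coind_bot (Rep.res (⊥ : Subgroup G).subtype A)
  have h : IsZero (groupCohomology (cokernel (coindUnit ⊥ A)) (n + 1)) := by
    cases n with
    | zero => exact isZero_groupCohomology_one_of_epi (cokernel.π (coindUnit ⊥ A)) (hW 0)
    | succ n => exact isZero_groupCohomology_of_isFreeGroup _ n
  exact (mapShortComplex₁_exact hX (i := n + 1) rfl).isZero_of_both_zeros
    (h.eq_of_src _ _) ((hW (n + 1)).eq_of_tgt _ _)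

variable {k : Type} [Field k] (S : Subgroup G) (A : Rep k G)

/-- The value `ρ(g) f(g⁻¹)` of a function `f` in the representation coinduced from the subgroup
`S`: it depends only on the coset `gS`. -/
def coindValue (f : Rep.coind S.subtype (Rep.res S.subtype A)) (q : G ⧸ S) : A :=
  A.ρ q.out (f.1 q.out⁻¹)

theorem coindValue_mk (f : Rep.coind S.subtype (Rep.res S.subtype A)) (g : G) :
    coindValue S A f (g : G ⧸ S) = A.ρ g (f.1 g⁻¹) := by
  obtain ⟨s, hs⟩ := QuotientGroup.mk_out_eq_mul S g
  have h : f.1 ((s⁻¹ : S) * g⁻¹) = A.ρ (s⁻¹ : S) (f.1 g⁻¹) := f.2 s⁻¹ g⁻¹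
  rw [coindValue, hs, mul_inv_rev, ← Subgroup.coe_inv, h, map_mul, Module.End.mul_apply,
    Subgroup.coe_inv, Representation.self_inv_apply]

theorem coindValue_rho (f : Rep.coind S.subtype (Rep.res S.subtype A)) (g : G) (q : G ⧸ S) :
    coindValue S A ((Rep.coind S.subtype (Rep.res S.subtype A)).ρ g f) q =
      A.ρ g (coindValue S A f (g⁻¹ • q)) := by
  induction q using QuotientGroup.induction_on with | _ x
  have h : g⁻¹ • (x : G ⧸ S) = ((g⁻¹ * x : G) : G ⧸ S) := rfl
  rw [h, coindValue_mk, coindValue_mk, ← Module.End.mul_apply, ← map_mul,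
    mul_inv_cancel_left, mul_inv_rev, inv_inv]
  rfl

attribute [local instance] Subgroup.fintypeQuotientOfFiniteIndex

/-- The average of the values of a function in the representation coinduced from a subgroup of
finite index. -/
def coindAverage [S.FiniteIndex] : Rep.coind S.subtype (Rep.res S.subtype A) ⟶ A :=
  Rep.ofHom
    { toFun := fun f => (Fintype.card (G ⧸ S) : k)⁻¹ • ∑ q : G ⧸ S, coindValue S A f q
      map_add' := fun f g => by
        simp [coindValue, Finset.sum_add_distrib]
      map_smul' := fun c f => by
        simp [coindValue, ← Finset.smul_sum, smul_comm c]
      isIntertwining' := fun g => by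
        ext f
        change (Fintype.card (G ⧸ S) : k)⁻¹ • ∑ q : G ⧸ S, coindValue S A _ q =
          A.ρ g ((Fintype.card (G ⧸ S) : k)⁻¹ • ∑ q : G ⧸ S, coindValue S A f q)
        rw [map_smul, map_sum]
        congr 1
        refine Fintype.sum_equiv (MulAction.toPerm g⁻¹) _ _ fun q => ?_
        exact coindValue_rho S A f g q }

/-- The function attached to `a` has value `a` on every coset, so its average is `a`; characteristic
zero makes the index invertible. -/
theorem coindUnit_comp_coindAverage [S.FiniteIndex] [CharZero k] :
    coindUnit S A ≫ coindAverage S A = 𝟙 A := by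
  ext a
  change (Fintype.card (G ⧸ S) : k)⁻¹ • ∑ q : G ⧸ S, coindValue S A ((coindUnit S A).hom a) q = a
  have h : ∀ q : G ⧸ S, coindValue S A ((coindUnit S A).hom a) q = a := fun q => by
    rw [coindValue, coindUnit_apply, Representation.self_inv_apply]
  have hc : (Fintype.card (G ⧸ S) : k) ≠ 0 := Nat.cast_ne_zero.2 Fintype.card_ne_zero
  rw [Finset.sum_congr rfl fun q _ => h q, Finset.sum_const, Finset.card_univ,
    ← Nat.cast_smul_eq_nsmul k, smul_smul, inv_mul_cancel₀ hc, one_smul]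

theorem isZero_groupCohomology_of_finiteIndex_isFreeGroup [S.FiniteIndex] [IsFreeGroup S]
    [CharZero k] (n : ℕ) : IsZero (groupCohomology A (n + 2)) :=
  isZero_groupCohomology_of_retract _ _ (coindUnit_comp_coindAverage S A)
    ((isZero_groupCohomology_of_isFreeGroup _ n).of_iso (coindIso _ _))

end Cohomology

/-! ### A free subgroup of finite index in `SL_2(ℤ)` -/

section Sanov

open Matrix MatrixGroups

/-- The matrices `(1 2; 0 1)` and `(1 0; 2 1)`. -/
def sanovGen (b : Bool) : SL(2, ℤ) :=
  if b then ⟨!![1, 0; 2, 1], by simp⟩ else ⟨!![1, 2; 0, 1], by simp⟩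

/-- The four inclusions of the ping-pong argument for a nonzero column `(x, y)`, each hypothesis
being the complement of one region. The axes and diagonals cut the plane into four regions,
according to the sign of `xy` and the larger of `|x|`, `|y|`. The points with `x = y` are put on the
side of `(1 2; 0 1)`; since `(1 0; 2 1)⁻¹` maps `(x, x)` to `(x, -x)`, those with `x = -y` go to the
other side. -/
theorem sanov_ineq {x y : ℤ} (h : x ≠ 0 ∨ y ≠ 0) :
    ((x * y < 0 → x ^ 2 ≤ y ^ 2) →
      0 ≤ (x + 2 * y) * y ∧ y ^ 2 ≤ (x + 2 * y) ^ 2) ∧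
    ((x * y < 0 → y ^ 2 < x ^ 2) →
      0 ≤ x * (2 * x + y) ∧ x ^ 2 < (2 * x + y) ^ 2) ∧
    ((0 ≤ x * y → x ^ 2 < y ^ 2) →
      (x + -(2 * y)) * y < 0 ∧ y ^ 2 < (x + -(2 * y)) ^ 2) ∧
    ((0 ≤ x * y → y ^ 2 ≤ x ^ 2) →
      x * (-(2 * x) + y) < 0 ∧ x ^ 2 ≤ (-(2 * x) + y) ^ 2) := by
  have hpos : 0 < x ^ 2 + y ^ 2 := by
    rcases h with h | h <;> positivity
  have hx := sq_nonneg x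
  have hy := sq_nonneg y
  have h1 : 0 ≤ x ^ 2 + 2 * (x * y) + y ^ 2 := by nlinarith [sq_nonneg (x + y)]
  have h2 : 0 ≤ x ^ 2 - 2 * (x * y) + y ^ 2 := by nlinarith [sq_nonneg (x - y)]
  have e1 : x ^ 2 ≤ y ^ 2 → |x * y| ≤ y ^ 2 := fun h => by
    rw [abs_mul, ← sq_abs y, sq]
    exact mul_le_mul_of_nonneg_right (sq_le_sq.1 h) (abs_nonneg y)
  have e2 : y ^ 2 ≤ x ^ 2 → |x * y| ≤ x ^ 2 := fun h => by
    rw [abs_mul, ← sq_abs x, sq]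
    exact mul_le_mul_of_nonneg_left (sq_le_sq.1 h) (abs_nonneg x)
  have a1 := neg_abs_le (x * y)
  have a2 := le_abs_self (x * y)
  refine ⟨fun H => ?_, fun H => ?_, fun H => ?_, fun H => ?_⟩
  · rcases lt_or_ge (x * y) 0 with h0 | h0
    · have := e1 (H h0)
      constructor <;> linarith
    · constructor <;> linarith
  · rcases lt_or_ge (x * y) 0 with h0 | h0
    · have := e2 (H h0).le
      have := H h0
      constructor <;> linarith
    · constructor <;> linarith
  · rcases lt_or_ge (x * y) 0 with h0 | h0
    · constructor <;> linarith
    · have := e1 (H h0).le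
      have := H h0
      constructor <;> linarith
  · rcases lt_or_ge (x * y) 0 with h0 | h0
    · constructor <;> linarith
    · have := e2 (H h0)
      have := H h0
      constructor <;> linarith

theorem coe_sanovGen_false : (sanovGen false : Matrix (Fin 2) (Fin 2) ℤ) = !![1, 2; 0, 1] := rfl

theorem coe_sanovGen_true : (sanovGen true : Matrix (Fin 2) (Fin 2) ℤ) = !![1, 0; 2, 1] := rfl

theorem sanovGen_mul (g : SL(2, ℤ)) :
    (sanovGen false * g) 0 0 = g 0 0 + 2 * g 1 0 ∧ (sanovGen false * g) 1 0 = g 1 0 ∧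
      (sanovGen true * g) 0 0 = g 0 0 ∧ (sanovGen true * g) 1 0 = 2 * g 0 0 + g 1 0 := by
  simp [coe_sanovGen_false, coe_sanovGen_true, Matrix.mul_apply, Fin.sum_univ_two]

theorem sanovGen_inv_mul (g : SL(2, ℤ)) :
    ((sanovGen false)⁻¹ * g) 0 0 = g 0 0 + -(2 * g 1 0) ∧
      ((sanovGen false)⁻¹ * g) 1 0 = g 1 0 ∧ ((sanovGen true)⁻¹ * g) 0 0 = g 0 0 ∧
      ((sanovGen true)⁻¹ * g) 1 0 = -(2 * g 0 0) + g 1 0 := by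
  simp [coe_sanovGen_false, coe_sanovGen_true, Matrix.adjugate_fin_two, Matrix.mul_apply,
    Fin.sum_univ_two]

-- Ping-pong for left multiplication on `SL_2(ℤ)` itself. The regions depend only on the first
-- column, which never vanishes.
open Pointwise in
theorem lift_sanovGen_injective : Function.Injective (FreeGroup.lift sanovGen) := by
  have hcol : ∀ g : SL(2, ℤ), g 0 0 ≠ 0 ∨ g 1 0 ≠ 0 := fun g => by
    by_contra! h
    have := g.det_coe
    rw [Matrix.det_fin_two, h.1, h.2] at this
    simp at this
  refine FreeGroup.injective_lift_of_ping_pong (α := SL(2, ℤ)) sanovGen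
    (fun b => if b then {g | 0 ≤ g 0 0 * g 1 0 ∧ g 0 0 ^ 2 < g 1 0 ^ 2}
      else {g | 0 ≤ g 0 0 * g 1 0 ∧ g 1 0 ^ 2 ≤ g 0 0 ^ 2})
    (fun b => if b then {g | g 0 0 * g 1 0 < 0 ∧ g 0 0 ^ 2 ≤ g 1 0 ^ 2}
      else {g | g 0 0 * g 1 0 < 0 ∧ g 1 0 ^ 2 < g 0 0 ^ 2}) ?_ ?_ ?_ ?_ ?_ ?_
  · rintro (_ | _)
    · exact ⟨1, by simp⟩
    · exact ⟨ModularGroup.S, by constructor <;> decide⟩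
  · rintro (_ | _) (_ | _) h <;> simp [Function.onFun, Set.disjoint_left] at h ⊢ <;>
      omega
  · rintro (_ | _) (_ | _) h <;> simp [Function.onFun, Set.disjoint_left] at h ⊢ <;>
      omega
  · rintro (_ | _) (_ | _) <;> simp [Set.disjoint_left] <;>
      omega
  · rintro (_ | _) _ ⟨g, hg, rfl⟩
    · simp at hg
      change 0 ≤ (sanovGen false * g) 0 0 * (sanovGen false * g) 1 0 ∧
        (sanovGen false * g) 1 0 ^ 2 ≤ (sanovGen false * g) 0 0 ^ 2
      rw [(sanovGen_mul g).1, (sanovGen_mul g).2.1]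
      exact (sanov_ineq (hcol g)).1 hg
    · simp at hg
      change 0 ≤ (sanovGen true * g) 0 0 * (sanovGen true * g) 1 0 ∧
        (sanovGen true * g) 0 0 ^ 2 < (sanovGen true * g) 1 0 ^ 2
      rw [(sanovGen_mul g).2.2.1, (sanovGen_mul g).2.2.2]
      exact (sanov_ineq (hcol g)).2.1 hg
  · rintro (_ | _) _ ⟨g, hg, rfl⟩
    · simp at hg
      change ((sanovGen false)⁻¹ * g) 0 0 * ((sanovGen false)⁻¹ * g) 1 0 < 0 ∧
        ((sanovGen false)⁻¹ * g) 1 0 ^ 2 < ((sanovGen false)⁻¹ * g) 0 0 ^ 2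
      rw [(sanovGen_inv_mul g).1, (sanovGen_inv_mul g).2.1]
      exact (sanov_ineq (hcol g)).2.2.1 hg
    · simp at hg
      change ((sanovGen true)⁻¹ * g) 0 0 * ((sanovGen true)⁻¹ * g) 1 0 < 0 ∧
        ((sanovGen true)⁻¹ * g) 0 0 ^ 2 ≤ ((sanovGen true)⁻¹ * g) 1 0 ^ 2
      rw [(sanovGen_inv_mul g).2.2.1, (sanovGen_inv_mul g).2.2.2]
      exact (sanov_ineq (hcol g)).2.2.2 hg

/-- A subgroup of finite index from a finite set of cosets that is stable by generators. -/
theorem finiteIndex_of_stable {G : Type} [Group G] (H : Subgroup G) (A : Set G)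
    (hA : Subgroup.closure A = ⊤) (R : Set G) (hR : R.Finite) (h1 : 1 ∈ R)
    (h : ∀ a ∈ A, ∀ r ∈ R, ∃ r' ∈ R, r'⁻¹ * (a * r) ∈ H) : H.FiniteIndex := by
  let F : Set (G ⧸ H) := (fun g : G => (g : G ⧸ H)) '' R
  have hF : F.Finite := hR.image _
  have key : ∀ g : G, ∀ q ∈ F, g • q ∈ F := by
    intro g
    have hg : g ∈ Subgroup.closure A := hA ▸ Subgroup.mem_top g
    induction hg using Subgroup.closure_induction with
    | mem a ha =>
      rintro _ ⟨r, hr, rfl⟩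
      obtain ⟨r', hr', hm⟩ := h a ha r hr
      exact ⟨r', hr', QuotientGroup.eq.2 hm⟩
    | one => simp
    | mul x y _ _ hx hy => exact fun q hq => mul_smul x y q ▸ hx _ (hy q hq)
    -- An injective map of a finite set to itself is surjective, so stability by `x` gives stability
    -- by `x⁻¹`.
    | inv x _ hx =>
      intro q hq
      obtain ⟨q', hq', h'⟩ := (hF.injOn_iff_bijOn_of_mapsTo (f := (x • ·)) hx).1
        ((MulAction.injective x).injOn) |>.surjOn hq
      rw [← h']
      simpa using hq'
  have hfin : Finite (G ⧸ H) := by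
    refine Set.finite_univ_iff.1 (hF.subset fun q _ => ?_)
    induction q using QuotientGroup.induction_on with | _ g
    simpa using key g _ ⟨1, h1, rfl⟩
  exact Subgroup.finiteIndex_of_finite_quotient

/-- Representatives of the cosets of the subgroup generated by `sanovGen`. -/
def sanovReps : List SL(2, ℤ) :=
  [1, ModularGroup.S, ModularGroup.T, ModularGroup.T * ModularGroup.S,
    ModularGroup.S * ModularGroup.T, ⟨!![1, 0; 1, 1], by simp⟩].flatMap fun r => [r, -r]

/-- A finite verification. The six matrices behind `sanovReps` reduce to the six elements of
`SL_2(𝔽_2)`; both signs occur because `-1` is trivial modulo 2 but does not lie in the free group.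
Seven short words in the generators suffice as corrections. -/
theorem exists_sanovReps : ∀ a ∈ [ModularGroup.S, ModularGroup.T], ∀ r ∈ sanovReps,
    ∃ r' ∈ sanovReps, ∃ h ∈ [1, sanovGen false, (sanovGen false)⁻¹, sanovGen true,
      (sanovGen true)⁻¹, (sanovGen false)⁻¹ * sanovGen true,
      (sanovGen true)⁻¹ * sanovGen false], r'⁻¹ * (a * r) = h := by
  decide +kernel

theorem range_lift_sanovGen_finiteIndex : (FreeGroup.lift sanovGen).range.FiniteIndex := by
  have hmem : ∀ b, sanovGen b ∈ (FreeGroup.lift sanovGen).range := fun b =>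
    ⟨FreeGroup.of b, FreeGroup.lift_apply_of⟩
  refine finiteIndex_of_stable _ _ SpecialLinearGroup.SL2Z_generators {r | r ∈ sanovReps}
    (List.finite_toSet _) (by simp [sanovReps]) fun a ha r hr => ?_
  obtain ⟨r', hr', h, hh, e⟩ := exists_sanovReps a (by simpa using ha) r hr
  refine ⟨r', hr', ?_⟩
  rw [e]
  simp only [List.mem_cons, List.not_mem_nil, or_false] at hh
  rcases hh with rfl | rfl | rfl | rfl | rfl | rfl | rfl <;>
    simp only [one_mem, mul_mem, inv_mem, hmem]

end Sanov

/-! ### Ideles of `ℚ` -/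

section Ideles

theorem isInt_of_padic_norm_le_one {q : ℚ} (h : ∀ ℓ : Nat.Primes, ‖(q : ℚ_[ℓ])‖ ≤ 1) :
    ∃ n : ℤ, (n : ℚ) = q := by
  refine ⟨q.num, (Rat.den_eq_one_iff q).1 ?_⟩
  by_contra hd
  obtain ⟨ℓ, hℓ, hdvd⟩ := Nat.exists_prime_and_dvd hd
  have : Fact ℓ.Prime := ⟨hℓ⟩
  have h1 : ‖((q.den : ℕ) : ℚ_[ℓ])‖ < 1 := Padic.norm_natCast_lt_one_iff.2 hdvd
  have h2 : ‖((q.num : ℤ) : ℚ_[ℓ])‖ < 1 := by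
    have e : ((q.num : ℤ) : ℚ_[ℓ]) = (q : ℚ_[ℓ]) * ((q.den : ℕ) : ℚ_[ℓ]) := by
      exact_mod_cast congrArg (Rat.cast : ℚ → ℚ_[ℓ]) (Rat.mul_den_eq_num q).symm
    rw [e, norm_mul]
    have h3 : ‖(q : ℚ_[ℓ])‖ ≤ 1 := h ⟨ℓ, hℓ⟩
    nlinarith [norm_nonneg (q : ℚ_[ℓ]), norm_nonneg ((q.den : ℕ) : ℚ_[ℓ])]
  rw [Padic.norm_intCast_lt_one_iff] at h2
  exact hℓ.one_lt.ne' (Nat.dvd_one.1 (q.reduced ▸ Nat.dvd_gcd (Int.natCast_dvd.1 h2) hdvd))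

/-- Both `q` and `q⁻¹` are integers, and the only positive unit of `ℤ` is 1. -/
theorem rat_eq_one {q : ℚ} (hq : 0 < q) (h : ∀ ℓ : Nat.Primes, ‖(q : ℚ_[ℓ])‖ = 1) : q = 1 := by
  obtain ⟨n, hn⟩ := isInt_of_padic_norm_le_one fun ℓ => (h ℓ).le
  obtain ⟨m, hm⟩ := isInt_of_padic_norm_le_one (q := q⁻¹) fun ℓ => by
    rw [Rat.cast_inv, norm_inv, h ℓ, inv_one]
  have h1 : n * m = 1 := by
    have : (n : ℚ) * m = 1 := by rw [hn, hm, mul_inv_cancel₀ hq.ne']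
    exact_mod_cast this
  have h2 : 0 < n := by
    rw [← hn] at hq
    exact_mod_cast hq
  rw [← hn, Int.eq_one_of_mul_eq_one_right h2.le h1, Int.cast_one]

theorem mem_padicIntSubring {ℓ : Nat.Primes} {x : ℚ_[ℓ]} :
    x ∈ (PadicInt.subring ℓ : Set ℚ_[ℓ]) ↔ ‖x‖ ≤ 1 := Iff.rfl

/-- The component of an idele at `ℓ`. -/
abbrev ideleAt (ℓ : Nat.Primes) : Adeleˣ →* ℚ_[ℓ]ˣ := Units.map (compAt ℓ : Adele →* ℚ_[ℓ])

theorem adele_ext {x y : Adele} (h : x.1 = y.1) (h' : ∀ ℓ, x.2 ℓ = y.2 ℓ) : x = y :=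
  Prod.ext h (RestrictedProduct.ext _ _ h')

theorem idele_norm_eventually (a : Adeleˣ) :
    ∀ᶠ ℓ : Nat.Primes in cofinite, ‖(a : Adele).2 ℓ‖ = 1 := by
  filter_upwards [(a : Adele).2.2, ((a⁻¹ : Adeleˣ) : Adele).2.2] with ℓ h1 h2
  have h3 : ‖(a : Adele).2 ℓ‖ * ‖((a⁻¹ : Adeleˣ) : Adele).2 ℓ‖ = 1 := by
    rw [← norm_mul]
    exact (congrArg norm (congrArg (compAt ℓ) a.mul_inv)).trans norm_one
  have h4 : ‖(a : Adele).2 ℓ‖ ≤ 1 := h1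
  have h5 : ‖((a⁻¹ : Adeleˣ) : Adele).2 ℓ‖ ≤ 1 := h2
  refine le_antisymm h4 ?_
  rw [← h3]
  exact mul_le_of_le_one_right (norm_nonneg _) h5

theorem idele_ne_zero (a : Adeleˣ) (ℓ : Nat.Primes) : (a : Adele).2 ℓ ≠ 0 :=
  (ideleAt ℓ a).ne_zero

theorem exists_idele {r : ℝ} (hr : r ≠ 0) (y : ∀ ℓ : Nat.Primes, ℚ_[ℓ]) (h0 : ∀ ℓ, y ℓ ≠ 0)
    (h1 : ∀ᶠ ℓ in cofinite, ‖y ℓ‖ = 1) :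
    ∃ a : Adeleˣ, (a : Adele).1 = r ∧ ∀ ℓ, (a : Adele).2 ℓ = y ℓ := by
  refine ⟨⟨(r, ⟨y, h1.mono fun ℓ h => mem_padicIntSubring.2 h.le⟩),
    (r⁻¹, ⟨fun ℓ => (y ℓ)⁻¹, h1.mono fun ℓ h => mem_padicIntSubring.2 (by simp [h])⟩), ?_, ?_⟩,
    rfl, fun _ => rfl⟩
  · exact adele_ext (mul_inv_cancel₀ hr) fun ℓ => mul_inv_cancel₀ (h0 ℓ)
  · exact adele_ext (inv_mul_cancel₀ hr) fun ℓ => inv_mul_cancel₀ (h0 ℓ)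

/-- This is class number one: the product of the prime powers prescribed by the finitely many
nonzero valuations is a rational number, and its sign is free to match that at infinity. -/
theorem exists_rat_norm_eq (a : Adeleˣ) :
    ∃ q : ℚˣ, 0 < (a : Adele).1 * ((q : ℚ) : ℝ) ∧
      ∀ ℓ : Nat.Primes, ‖((q : ℚ) : ℚ_[ℓ])‖ = ‖(a : Adele).2 ℓ‖ := by
  have hfin : {ℓ : Nat.Primes | ¬‖(a : Adele).2 ℓ‖ = 1}.Finite := idele_norm_eventually a
  let Q : ℚ := ∏ ℓ ∈ hfin.toFinset, ((ℓ : ℕ) : ℚ) ^ ((a : Adele).2 ℓ).valuation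
  have hQ : 0 < Q := Finset.prod_pos fun ℓ _ => zpow_pos (Nat.cast_pos.2 ℓ.2.pos) _
  have hnorm : ∀ ℓ : Nat.Primes, ‖(Q : ℚ_[ℓ])‖ = ‖(a : Adele).2 ℓ‖ := by
    intro ℓ
    have h1 : ∀ ℓ' : Nat.Primes, ℓ' ≠ ℓ →
        ‖(((ℓ' : ℕ) : ℚ_[ℓ]) ^ ((a : Adele).2 ℓ').valuation)‖ = 1 := fun ℓ' h => by
      rw [norm_zpow, Padic.norm_natCast_eq_one_iff.2, one_zpow]
      exact (Nat.coprime_primes ℓ.2 ℓ'.2).2 fun h' => h (Subtype.ext h'.symm)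
    have h2 : (Q : ℚ_[ℓ]) =
        ∏ ℓ' ∈ hfin.toFinset, ((ℓ' : ℕ) : ℚ_[ℓ]) ^ ((a : Adele).2 ℓ').valuation := by
      simp [Q]
    rw [h2, norm_prod]
    by_cases hℓ : ‖(a : Adele).2 ℓ‖ = 1
    · rw [hℓ]
      refine Finset.prod_eq_one fun ℓ' hℓ' => h1 ℓ' ?_
      rintro rfl
      exact hfin.mem_toFinset.1 hℓ' hℓ
    · rw [Finset.prod_eq_single_of_mem ℓ (hfin.mem_toFinset.2 hℓ) fun ℓ' _ h => h1 ℓ' h,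
        Padic.norm_p_zpow, Padic.norm_eq_zpow_neg_valuation (idele_ne_zero a ℓ)]
  have ha : (a : Adele).1 ≠ 0 := (Units.map (compInfty : Adele →* ℝ) a).ne_zero
  rcases ha.lt_or_gt with h | h
  · refine ⟨-Units.mk0 Q hQ.ne', ?_, fun ℓ => ?_⟩
    · have : 0 < -(a : Adele).1 * (Q : ℝ) := mul_pos (neg_pos.2 h) (Rat.cast_pos.2 hQ)
      simpa using this
    · simpa using hnorm ℓ
  · exact ⟨Units.mk0 Q hQ.ne', mul_pos h (Rat.cast_pos.2 hQ), hnorm⟩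

theorem exists_zHatUnit (b : Adeleˣ) (hb : ∀ ℓ : Nat.Primes, ‖(b : Adele).2 ℓ‖ = 1) :
    ∃ u : ZHatˣ, ∀ ℓ : Nat.Primes, ((u : ZHat) ℓ : ℚ_[ℓ]) = (b : Adele).2 ℓ := by
  have hb' : ∀ ℓ : Nat.Primes, ‖((b⁻¹ : Adeleˣ) : Adele).2 ℓ‖ ≤ 1 := fun ℓ => by
    have h := congrArg Units.val (map_inv (ideleAt ℓ) b)
    rw [Units.val_inv_eq_inv_val] at h
    have h' : ((b⁻¹ : Adeleˣ) : Adele).2 ℓ = ((b : Adele).2 ℓ)⁻¹ := h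
    rw [h', norm_inv, hb, inv_one]
  refine ⟨⟨fun ℓ => ⟨(b : Adele).2 ℓ, (hb ℓ).le⟩, fun ℓ => ⟨_, hb' ℓ⟩, ?_, ?_⟩, fun ℓ => rfl⟩
  · funext ℓ
    exact Subtype.ext (congrArg (compAt ℓ) b.mul_inv)
  · funext ℓ
    exact Subtype.ext (congrArg (compAt ℓ) b.inv_mul)

/-- The subgroup `ℝ_+^* ℚ^*` of the group of ideles. -/
abbrev principalIdeles : Subgroup Adeleˣ := realPosIdeles ⊔ ratIdeles

theorem mul_zHatUnits_inv_mem_realPosIdeles {b : Adeleˣ} (hb : 0 < (b : Adele).1) {u : ZHatˣ}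
    (hu : ∀ ℓ : Nat.Primes, ((u : ZHat) ℓ : ℚ_[ℓ]) = (b : Adele).2 ℓ) :
    b * (zHatUnits u)⁻¹ ∈ realPosIdeles := by
  have h : b * (zHatUnits u)⁻¹ * zHatUnits u = b := by simp
  refine ⟨?_, ?_⟩
  · have h' := congrArg (fun x : Adeleˣ => (x : Adele).1) h
    have h'' : ((b * (zHatUnits u)⁻¹ : Adeleˣ) : Adele).1 * 1 = (b : Adele).1 := h'
    rw [mul_one] at h''
    rwa [h'']
  · refine RestrictedProduct.ext _ _ fun ℓ => ?_
    have h' : ((b * (zHatUnits u)⁻¹ : Adeleˣ) : Adele).2 ℓ * ((u : ZHat) ℓ : ℚ_[ℓ]) =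
      (b : Adele).2 ℓ := congrArg (fun x : Adeleˣ => (x : Adele).2 ℓ) h
    rw [hu] at h'
    exact (mul_eq_right₀ (idele_ne_zero b ℓ)).1 h'

/-- Division by the rational number of `exists_rat_norm_eq` leaves a unit at every prime and a
positive number at infinity. -/
theorem exists_zHatUnits_mul_inv_mem (a : Adeleˣ) :
    ∃ u : ZHatˣ, a * (zHatUnits u)⁻¹ ∈ principalIdeles := by
  obtain ⟨q, hq, hnorm⟩ := exists_rat_norm_eq a
  let Q : Adeleˣ := Units.map (ratAdele : ℚ →* Adele) q
  have hQ : ∀ ℓ : Nat.Primes, ((Q : Adeleˣ) : Adele).2 ℓ = ((q : ℚ) : ℚ_[ℓ]) := fun ℓ => rfl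
  let b : Adeleˣ := a * Q⁻¹
  have hbQ : b * Q = a := by simp [b]
  have hb : ∀ ℓ : Nat.Primes, ‖(b : Adele).2 ℓ‖ = 1 := fun ℓ => by
    have h : (b : Adele).2 ℓ * ((q : ℚ) : ℚ_[ℓ]) = (a : Adele).2 ℓ :=
      congrArg (fun x : Adeleˣ => (x : Adele).2 ℓ) hbQ
    have h' := congrArg norm h
    have h0 : ‖((q : ℚ) : ℚ_[ℓ])‖ ≠ 0 := by
      rw [hnorm, norm_ne_zero_iff]
      exact idele_ne_zero a ℓ
    rw [norm_mul, ← hnorm] at h'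
    exact (mul_eq_right₀ h0).1 h'
  have hb' : 0 < (b : Adele).1 := by
    have h : (b : Adele).1 * ((q : ℚ) : ℝ) = (a : Adele).1 :=
      congrArg (fun x : Adeleˣ => (x : Adele).1) hbQ
    rw [← h, mul_assoc] at hq
    exact pos_of_mul_pos_left hq (mul_self_nonneg _)
  obtain ⟨u, hu⟩ := exists_zHatUnit b hb
  refine ⟨u, ?_⟩
  have hr := mul_zHatUnits_inv_mem_realPosIdeles hb' hu
  have e : a * (zHatUnits u)⁻¹ = b * (zHatUnits u)⁻¹ * Q := by
    rw [← hbQ, mul_right_comm]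
  rw [e]
  exact mul_mem (Subgroup.mem_sup_left hr) (Subgroup.mem_sup_right ⟨q, rfl⟩)

/-- The rational factor has norm 1 at all primes and is positive, hence equals 1; the other factor
is trivial at all primes. -/
theorem eq_one_of_zHatUnits_mem {u : ZHatˣ} (hu : zHatUnits u ∈ principalIdeles) : u = 1 := by
  obtain ⟨r, hr, _, ⟨q, rfl⟩, h⟩ := Subgroup.mem_sup.1 hu
  have h1 : (r : Adele).1 * ((q : ℚ) : ℝ) = 1 := congrArg (fun x : Adeleˣ => (x : Adele).1) h
  have h2 : ∀ ℓ : Nat.Primes, ((q : ℚ) : ℚ_[ℓ]) = ((u : ZHat) ℓ : ℚ_[ℓ]) := fun ℓ => by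
    have h3 : (r : Adele).2 ℓ * ((q : ℚ) : ℚ_[ℓ]) = ((u : ZHat) ℓ : ℚ_[ℓ]) :=
      congrArg (fun x : Adeleˣ => (x : Adele).2 ℓ) h
    rwa [hr.2, show (1 : FinAdele) ℓ = 1 from rfl, one_mul] at h3
  have hq : 0 < (q : ℚ) := by
    have := (pos_iff_pos_of_mul_pos (h1 ▸ one_pos)).1 hr.1
    exact_mod_cast this
  have hq1 : (q : ℚ) = 1 := rat_eq_one hq fun ℓ => by
    rw [h2]
    exact PadicInt.isUnit_iff.1 ((Pi.isUnit_iff.1 u.isUnit) ℓ)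
  refine Units.ext (funext fun ℓ => Subtype.ext ?_)
  rw [← h2, hq1]
  exact Rat.cast_one

theorem zHatUnits_eq_of_mem {a : Adeleˣ} {u v : ZHatˣ}
    (hu : a * (zHatUnits u)⁻¹ ∈ principalIdeles) (hv : a * (zHatUnits v)⁻¹ ∈ principalIdeles) :
    u = v := by
  have h := mul_mem (inv_mem hv) hu
  have e : (a * (zHatUnits v)⁻¹)⁻¹ * (a * (zHatUnits u)⁻¹) = zHatUnits (v * u⁻¹) := by
    rw [map_mul, map_inv]
    group
  rw [e] at h
  exact (mul_inv_eq_one.1 (eq_one_of_zHatUnits_mem h)).symm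

/-- The projection of `𝔸^*` on `Ẑ^*`, with kernel `ℝ_+^* ℚ^*`. -/
def ideleProj : Adeleˣ →* ZHatˣ where
  toFun a := (exists_zHatUnits_mul_inv_mem a).choose
  map_one' := zHatUnits_eq_of_mem (exists_zHatUnits_mul_inv_mem 1).choose_spec (by simp)
  map_mul' a b := zHatUnits_eq_of_mem (exists_zHatUnits_mul_inv_mem (a * b)).choose_spec (by
    have h := mul_mem (exists_zHatUnits_mul_inv_mem a).choose_spec
      (exists_zHatUnits_mul_inv_mem b).choose_spec
    rw [map_mul, mul_inv, mul_mul_mul_comm]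
    exact h)

theorem mul_zHatUnits_ideleProj_inv_mem (a : Adeleˣ) :
    a * (zHatUnits (ideleProj a))⁻¹ ∈ principalIdeles :=
  (exists_zHatUnits_mul_inv_mem a).choose_spec

theorem ideleProj_eq {a : Adeleˣ} {u : ZHatˣ} (h : a * (zHatUnits u)⁻¹ ∈ principalIdeles) :
    ideleProj a = u :=
  zHatUnits_eq_of_mem (mul_zHatUnits_ideleProj_inv_mem a) h

theorem ideleProj_zHatUnits (u : ZHatˣ) : ideleProj (zHatUnits u) = u :=
  ideleProj_eq (by simp)

theorem ker_ideleProj : ideleProj.ker = principalIdeles := by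
  ext a
  rw [MonoidHom.mem_ker]
  refine ⟨fun h => ?_, fun h => ideleProj_eq (by simpa using h)⟩
  have := mul_zHatUnits_ideleProj_inv_mem a
  simpa [h] using this

end Ideles

/-! ### Approximation in the adeles -/

section Approximation

/-- The inclusion of `Ẑ` in the finite adeles. -/
def zHatFin (z : ZHat) : FinAdele :=
  ⟨fun ℓ => (z ℓ : ℚ_[ℓ]), Eventually.of_forall fun ℓ => (z ℓ).2⟩

theorem continuous_zHatFin : Continuous zHatFin :=
  (RestrictedProduct.isEmbedding_structureMap (R := fun ℓ : Nat.Primes => ℚ_[ℓ])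
    (A := fun ℓ : Nat.Primes => (PadicInt.subring ℓ : Set ℚ_[ℓ])) (𝓕 := cofinite)).continuous

/-- A basic neighbourhood constrains finitely many components modulo prime powers, so the Chinese
remainder theorem applies. -/
theorem denseRange_intCast_zHat : DenseRange (Int.cast : ℤ → ZHat) := by
  intro z
  rw [mem_closure_iff_nhds]
  intro V hV
  rw [nhds_pi, Filter.mem_pi] at hV
  obtain ⟨I, hI, t, ht, htV⟩ := hV
  have h1 : ∀ ℓ : Nat.Primes, ∃ k : ℕ, ∀ x : ℤ_[ℓ], x - z ℓ ∈ Ideal.span {((ℓ : ℕ) : ℤ_[ℓ]) ^ k} → x ∈ t ℓ := by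
    intro ℓ
    obtain ⟨ε, hε, hb⟩ := Metric.mem_nhds_iff.1 (ht ℓ)
    obtain ⟨k, hk⟩ := PadicInt.exists_pow_neg_lt ℓ hε
    refine ⟨k, fun x hx => hb ?_⟩
    rw [← PadicInt.norm_le_pow_iff_mem_span_pow] at hx
    rw [Metric.mem_ball, dist_eq_norm]
    exact hx.trans_lt hk
  choose k hk using h1
  obtain ⟨n, hn⟩ := Nat.chineseRemainderOfFinset (fun ℓ : Nat.Primes => (z ℓ).appr (k ℓ))
    (fun ℓ => (ℓ : ℕ) ^ k ℓ) hI.toFinset (fun ℓ _ => pow_ne_zero _ ℓ.2.ne_zero)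
    (fun ℓ _ ℓ' _ h => Nat.Coprime.pow _ _
      ((Nat.coprime_primes ℓ.2 ℓ'.2).2 fun h' => h (Subtype.ext h')))
  refine ⟨((n : ℤ) : ZHat), htV fun ℓ hℓ => hk ℓ _ ?_, ⟨n, rfl⟩⟩
  have h2 := hn ℓ (hI.mem_toFinset.2 hℓ)
  have h3 := PadicInt.appr_spec (k ℓ) (z ℓ)
  have h4 : ((n : ℤ) : ℤ_[ℓ]) - ((z ℓ).appr (k ℓ) : ℤ_[ℓ]) ∈
      Ideal.span {((ℓ : ℕ) : ℤ_[ℓ]) ^ k ℓ} := by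
    rw [Ideal.mem_span_singleton]
    have h5 := (Nat.modEq_iff_dvd.1 h2.symm)
    have := map_dvd (Int.castRingHom ℤ_[ℓ]) h5
    simpa using this
  have := sub_mem h4 h3
  simpa using this

/-- For an integer `n`, removing the real component of the diagonal `n` leaves an element of `S`;
the closure of these elements contains `Ẑ`. -/
theorem addSubgroup_adele_eq_top_aux (S : AddSubgroup Adele) (hS : IsClosed (S : Set Adele))
    (hQ : ∀ q : ℚ, ratAdele q ∈ S) (hR : ∀ r : ℝ, ((r, 0) : Adele) ∈ S) (z : ZHat) :
    ((0, zHatFin z) : Adele) ∈ S := by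
  have hc : Continuous fun z : ZHat => ((0, zHatFin z) : Adele) :=
    continuous_const.prodMk continuous_zHatFin
  have hcl := hS.preimage hc
  refine hcl.closure_subset_iff.2 ?_ (denseRange_intCast_zHat z)
  rintro _ ⟨n, rfl⟩
  have h := sub_mem (hQ n) (hR n)
  have e : ratAdele n - ((n : ℝ), 0) =
      ((0, zHatFin (n : ZHat)) : Adele) := by
    refine adele_ext ?_ fun ℓ => ?_
    · change ((n : ℚ) : ℝ) - (n : ℝ) = 0
      simp
    · change (((n : ℤ) : ℚ) : ℚ_[ℓ]) - 0 = (((n : ℤ_[ℓ])) : ℚ_[ℓ])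
      simp
  rw [e] at h
  exact h

/-- `ℚ + ℝ` is dense in the adeles. -/
theorem addSubgroup_adele_eq_top (S : AddSubgroup Adele) (hS : IsClosed (S : Set Adele))
    (hQ : ∀ q : ℚ, ratAdele q ∈ S) (hR : ∀ r : ℝ, ((r, 0) : Adele) ∈ S) (t : Adele) : t ∈ S := by
  classical
  -- The idele `a` records the denominators of `t`: its norm at `ℓ` is `max(1, ‖t_ℓ‖)`. A rational
  -- `q` with the same norms makes `q⁻¹ t` integral at every prime, and the preimage of `S` under
  -- multiplication by `q` satisfies the same hypotheses.
  obtain ⟨a, -, ha⟩ := exists_idele one_ne_zero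
    (fun ℓ => if ‖t.2 ℓ‖ ≤ 1 then 1 else t.2 ℓ)
    (fun ℓ => by
      split_ifs with h
      · exact one_ne_zero
      · rintro h'
        simp [h'] at h)
    (by
      filter_upwards [t.2.2] with ℓ hℓ
      rw [if_pos (show ‖t.2 ℓ‖ ≤ 1 from hℓ), norm_one])
  obtain ⟨q, -, hq⟩ := exists_rat_norm_eq a
  have hz : ∀ ℓ : Nat.Primes, ‖(((q⁻¹ : ℚˣ) : ℚ) : ℚ_[ℓ]) * t.2 ℓ‖ ≤ 1 := fun ℓ => by
    rw [Units.val_inv_eq_inv_val, Rat.cast_inv, norm_mul, norm_inv, hq, ha]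
    split_ifs with h
    · simpa using h
    · rw [inv_mul_cancel₀]
      intro h'
      simp [h'] at h
  let m : Adele →+ Adele := AddMonoidHom.mulLeft (ratAdele q)
  have hm : Continuous m := continuous_const_mul _
  have h := addSubgroup_adele_eq_top_aux (S.comap m) (hS.preimage hm)
    (fun r => by
      change ratAdele q * ratAdele r ∈ S
      rw [← map_mul]
      exact hQ _)
    (fun r => by
      have e : m (r, 0) = (((q : ℚ) : ℝ) * r, 0) := adele_ext rfl fun ℓ => mul_zero _
      change m (r, 0) ∈ S
      rw [e]
      exact hR _)
    (fun ℓ => ⟨_, hz ℓ⟩)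
  have e : t = m (0, zHatFin fun ℓ => ⟨_, hz ℓ⟩) + (t.1, 0) := by
    refine adele_ext ?_ fun ℓ => ?_
    · change t.1 = ((q : ℚ) : ℝ) * 0 + t.1
      simp
    · change t.2 ℓ = ((q : ℚ) : ℚ_[ℓ]) * ((((q⁻¹ : ℚˣ) : ℚ) : ℚ_[ℓ]) * t.2 ℓ) + 0
      rw [← mul_assoc, ← Rat.cast_mul, Units.mul_inv, Rat.cast_one, one_mul, add_zero]
  rw [e]
  exact add_mem h (hR _)

/-- The adeles have stable rank one: a unimodular pair `(a, c)` that is completed in a matrix of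
determinant one gives a unit `c + t a`. -/
theorem exists_isUnit_add_mul (a b c d : Adele) (h : a * d - b * c = 1) :
    ∃ t : Adele, IsUnit (c + t * a) := by
  classical
  have hr : a.1 * d.1 - b.1 * c.1 = 1 := congrArg Prod.fst h
  have hℓ : ∀ ℓ : Nat.Primes, a.2 ℓ * d.2 ℓ - b.2 ℓ * c.2 ℓ = 1 := fun ℓ =>
    congrArg (fun x : Adele => x.2 ℓ) h
  -- The choice is made prime by prime. Where everything is integral and `c` is not a unit, the
  -- determinant relation forces `a` to be a unit, so `c + a` is a unit. At the remaining finitely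
  -- many primes nonvanishing suffices, and `c`, `c + a` cannot both vanish.
  let s : ∀ ℓ : Nat.Primes, ℚ_[ℓ] := fun ℓ =>
    if ‖c.2 ℓ‖ = 1 then 0 else if c.2 ℓ + a.2 ℓ = 0 then 0 else 1
  have hs : ∀ ℓ : Nat.Primes, s ℓ ∈ (PadicInt.subring ℓ : Set ℚ_[ℓ]) := fun ℓ => by
    rw [mem_padicIntSubring]
    simp only [s]
    split_ifs <;> simp
  let t : Adele := (if c.1 = 0 then 1 else 0, ⟨s, Eventually.of_forall hs⟩)
  have h1 : (c + t * a).1 ≠ 0 := by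
    change c.1 + (if c.1 = 0 then 1 else 0) * a.1 ≠ 0
    split_ifs with h0
    · rintro h'
      rw [h0, zero_add, one_mul] at h'
      simp [h0, h'] at hr
    · simpa using h0
  have h2 : ∀ ℓ, (c + t * a).2 ℓ ≠ 0 := fun ℓ => by
    change c.2 ℓ + (if ‖c.2 ℓ‖ = 1 then 0 else if c.2 ℓ + a.2 ℓ = 0 then 0 else 1) * a.2 ℓ ≠ 0
    split_ifs with h0 h0'
    · rintro h'
      simp [show c.2 ℓ = 0 by simpa using h'] at h0
    · rintro h'
      have hc : c.2 ℓ = 0 := by simpa using h'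
      have ha : a.2 ℓ = 0 := by simpa [hc] using h0'
      have := hℓ ℓ
      simp [hc, ha] at this
    · simpa using h0'
  have h3 : ∀ᶠ ℓ : Nat.Primes in cofinite, ‖(c + t * a).2 ℓ‖ = 1 := by
    filter_upwards [a.2.2, b.2.2, c.2.2, d.2.2] with ℓ ha hb hc hd
    rw [mem_padicIntSubring] at ha hb hc hd
    change ‖c.2 ℓ + (if ‖c.2 ℓ‖ = 1 then 0 else if c.2 ℓ + a.2 ℓ = 0 then 0 else 1) * a.2 ℓ‖ = 1
    split_ifs with h0 h0'
    · simpa using h0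
    all_goals
      have hc' : ‖c.2 ℓ‖ < 1 := lt_of_le_of_ne hc h0
      have hbc : ‖b.2 ℓ * c.2 ℓ‖ < 1 := by
        rw [norm_mul]
        exact (mul_le_of_le_one_left (norm_nonneg _) hb).trans_lt hc'
      have had : ‖a.2 ℓ * d.2 ℓ‖ = 1 := by
        have e : a.2 ℓ * d.2 ℓ = 1 + b.2 ℓ * c.2 ℓ := by rw [← hℓ ℓ]; ring
        rw [e, IsUltrametricDist.norm_add_eq_max_of_norm_ne_norm (by rw [norm_one]; exact hbc.ne'),
          norm_one, max_eq_left hbc.le]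
      have ha1 : ‖a.2 ℓ‖ = 1 := by
        refine le_antisymm ha ?_
        rw [← had, norm_mul]
        exact mul_le_of_le_one_right (norm_nonneg _) hd
    · have : ‖c.2 ℓ‖ = 1 := by rw [eq_neg_of_add_eq_zero_left h0', norm_neg, ha1]
      exact absurd this h0
    · rw [one_mul, IsUltrametricDist.norm_add_eq_max_of_norm_ne_norm (by rw [ha1]; exact h0), ha1,
        max_eq_right hc'.le]
  obtain ⟨y, hy, hy'⟩ := exists_idele h1 (fun ℓ => (c + t * a).2 ℓ) h2 h3
  exact ⟨t, y, adele_ext hy hy'⟩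

end Approximation

/-! ### Elementary matrices of size two over a commutative ring -/

section Elementary

variable {R : Type} [CommRing R]

/-- The matrix `(1 t; 0 1)`. -/
def upperGL (t : R) : GL (Fin 2) R :=
  ⟨!![1, t; 0, 1], !![1, -t; 0, 1], by simp [Matrix.one_fin_two], by simp [Matrix.one_fin_two]⟩

/-- The matrix `(1 0; t 1)`. -/
def lowerGL (t : R) : GL (Fin 2) R :=
  ⟨!![1, 0; t, 1], !![1, 0; -t, 1], by simp [Matrix.one_fin_two], by simp [Matrix.one_fin_two]⟩

/-- The matrix `(0 1; 1 0)`. -/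
def swapGL : GL (Fin 2) R :=
  ⟨!![0, 1; 1, 0], !![0, 1; 1, 0], by simp [Matrix.one_fin_two], by simp [Matrix.one_fin_two]⟩

/-- The matrix `(a 0; 0 1)`. -/
def diagGL : Rˣ →* GL (Fin 2) R where
  toFun a := ⟨!![(a : R), 0; 0, 1], !![((a⁻¹ : Rˣ) : R), 0; 0, 1],
    by simp [Matrix.one_fin_two], by simp [Matrix.one_fin_two]⟩
  map_one' := Units.ext (by simp [Matrix.one_fin_two])
  map_mul' a b := Units.ext (by simp)

theorem det_diagGL (a : Rˣ) : Matrix.GeneralLinearGroup.det (diagGL a) = a :=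
  Units.ext (by simp [diagGL])

theorem upperGL_add (s t : R) : upperGL (s + t) = upperGL s * upperGL t :=
  Units.ext (by simp [upperGL, add_comm])

theorem swapGL_conj_upperGL (t : R) : swapGL * upperGL t * swapGL = lowerGL t :=
  Units.ext (by simp [upperGL, swapGL, lowerGL])

theorem map_upperGL {R' : Type} [CommRing R'] (f : R →+* R') (t : R) :
    Matrix.GeneralLinearGroup.map f (upperGL t) = upperGL (f t) := by
  ext i j
  fin_cases i <;> fin_cases j <;> simp [upperGL]

theorem map_swapGL {R' : Type} [CommRing R'] (f : R →+* R') :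
    Matrix.GeneralLinearGroup.map f swapGL = swapGL := by
  ext i j
  fin_cases i <;> fin_cases j <;> simp [swapGL]

theorem map_diagGL {R' : Type} [CommRing R'] (f : R →+* R') (a : Rˣ) :
    Matrix.GeneralLinearGroup.map f (diagGL a) = diagGL (Units.map (f : R →* R') a) := by
  ext i j
  fin_cases i <;> fin_cases j <;> simp [diagGL]

/-- A matrix of determinant one is a product of elementary matrices if its first column can be
reduced. -/
theorem mem_of_elementary_mem (N : Subgroup (GL (Fin 2) R)) (hu : ∀ t : R, upperGL t ∈ N)
    (hl : ∀ t : R, lowerGL t ∈ N) (x : GL (Fin 2) R) (hx : (x : Matrix (Fin 2) (Fin 2) R).det = 1) (t : R)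
    (ht : IsUnit (x 1 0 + t * x 0 0)) : x ∈ N := by
  have key : ∀ y : GL (Fin 2) R, (y : Matrix (Fin 2) (Fin 2) R).det = 1 → IsUnit (y 1 0) → y ∈ N := by
    intro y hy hc
    obtain ⟨c, hc⟩ := hc
    -- With `c` invertible in the lower left corner, the two outer factors adjust the diagonal
    -- entries; the upper right entry is then forced by the determinant.
    have e : y = upperGL ((y 0 0 - 1) * ↑c⁻¹) * lowerGL (c : R) *
        upperGL ((y 1 1 - 1) * ↑c⁻¹) := by
      have h1 : (↑c⁻¹ : R) * c = 1 := c.inv_mul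
      have hdet := Matrix.det_fin_two (y : Matrix (Fin 2) (Fin 2) R) ▸ hy
      rw [← hc] at hdet
      ext i j
      fin_cases i <;> fin_cases j <;> simp [upperGL, lowerGL, ← hc]
      · linear_combination (-y 0 1) * h1 - (↑c⁻¹ : R) * hdet
      · linear_combination (-(y 1 1 - 1)) * h1
    rw [e]
    exact mul_mem (mul_mem (hu _) (hl _)) (hu _)
  have h : lowerGL t * x ∈ N := by
    refine key _ (by rw [Units.val_mul, Matrix.det_mul, hx]; simp [lowerGL]) ?_
    simpa [lowerGL, Matrix.mul_apply, Fin.sum_univ_two, add_comm] using ht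
  exact (N.mul_mem_cancel_left (hl t)).1 h

end Elementary

/-! ### Left invariant functions on `GL_2(𝔸)` -/

section Invariant

open Matrix

theorem continuous_matrix_fin_two {X R : Type} [TopologicalSpace X] [TopologicalSpace R]
    {f g h k : X → R} (hf : Continuous f) (hg : Continuous g) (hh : Continuous h)
    (hk : Continuous k) : Continuous fun x => !![f x, g x; h x, k x] :=
  continuous_matrix fun i j => by fin_cases i <;> fin_cases j <;> assumption

theorem continuous_upperGL : Continuous (upperGL : Adele → GLA) :=
  Units.continuous_iff.2 ⟨continuous_matrix_fin_two continuous_const continuous_id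
    continuous_const continuous_const, continuous_matrix_fin_two continuous_const continuous_neg
    continuous_const continuous_const⟩

theorem continuous_diagGL : Continuous (diagGL : Adeleˣ → GLA) :=
  Units.continuous_iff.2 ⟨continuous_matrix_fin_two Units.continuous_val continuous_const
    continuous_const continuous_const, continuous_matrix_fin_two Units.continuous_coe_inv
    continuous_const continuous_const continuous_const⟩

/-- The group of left periods of a function. -/
def leftPeriods {H Z : Type} [Group H] (φ : H → Z) : Subgroup H where
  carrier := {h | ∀ y, φ (h * y) = φ y}
  one_mem' y := by rw [one_mul]
  mul_mem' {g h} hg hh y := by rw [mul_assoc, hg, hh]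
  inv_mem' {g} hg y := by rw [← hg, mul_inv_cancel_left]

theorem isClosed_leftPeriods {H Z : Type} [Group H] [TopologicalSpace H] [IsTopologicalGroup H]
    [TopologicalSpace Z] [T1Space Z] {φ : H → Z} (hφ : Continuous φ) :
    IsClosed (leftPeriods φ : Set H) := by
  have e : (leftPeriods φ : Set H) = ⋂ y, {h | φ (h * y) = φ y} := by
    ext h
    simp [leftPeriods]
  rw [e]
  refine isClosed_iInter fun y => ?_
  exact isClosed_singleton.preimage (hφ.comp (continuous_mul_const y))

/-- The image of `ℝ` in `Z` is connected, hence a single point. -/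
theorem mem_leftPeriods_of_real {Z : Type} [TopologicalSpace Z] [TotallyDisconnectedSpace Z]
    {φ : GLA → Z} (hφ : Continuous φ) {f : ℝ → GLA} (hf : Continuous f) (h0 : f 0 = 1) (r : ℝ) :
    f r ∈ leftPeriods φ := by
  intro y
  have hc : Continuous fun r => φ (f r * y) := by fun_prop
  have h := (isPreconnected_univ.image _ hc.continuousOn).subsingleton
    ⟨r, trivial, rfl⟩ ⟨0, trivial, rfl⟩
  simpa [h0] using h

variable {Z : Type} [TopologicalSpace Z] [T1Space Z] [TotallyDisconnectedSpace Z]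
  {φ : GLA → Z}

/-- The unipotent periods form a closed additive subgroup of `𝔸`, which contains `ℚ` by invariance
and `ℝ` by connectedness. -/
theorem upperGL_mem_leftPeriods (hφ : Continuous φ) (hinv : ∀ γ, ratGL γ ∈ leftPeriods φ)
    (t : Adele) : upperGL t ∈ leftPeriods φ := by
  let S : AddSubgroup Adele :=
    { carrier := {t | upperGL t ∈ leftPeriods φ}
      zero_mem' := by
        have e : (upperGL 0 : GLA) = 1 := Units.ext (by simp [upperGL, Matrix.one_fin_two])
        change upperGL 0 ∈ leftPeriods φ
        rw [e]
        exact one_mem _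
      add_mem' := fun {s t} hs ht => by
        change upperGL (s + t) ∈ leftPeriods φ
        rw [upperGL_add]
        exact mul_mem hs ht
      neg_mem' := fun {t} ht => by
        have e : (upperGL (-t) : GLA) = (upperGL t)⁻¹ := Units.ext rfl
        change upperGL (-t) ∈ leftPeriods φ
        rw [e]
        exact inv_mem ht }
  refine addSubgroup_adele_eq_top S ((isClosed_leftPeriods hφ).preimage continuous_upperGL)
    (fun q => ?_) (fun r => ?_) t
  · have h := hinv (upperGL q)
    rwa [ratGL, map_upperGL] at h
  · refine mem_leftPeriods_of_real hφ (f := fun r => upperGL (r, 0)) ?_ ?_ r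
    · exact continuous_upperGL.comp (by fun_prop)
    · exact Units.ext (by simp [upperGL, Matrix.one_fin_two, ← Prod.zero_eq_mk])

theorem mem_leftPeriods_of_det_eq_one (hφ : Continuous φ) (hinv : ∀ γ, ratGL γ ∈ leftPeriods φ)
    (x : GLA) (hx : (x : Matrix (Fin 2) (Fin 2) Adele).det = 1) : x ∈ leftPeriods φ := by
  have hu := upperGL_mem_leftPeriods hφ hinv
  have hl : ∀ t, lowerGL t ∈ leftPeriods φ := fun t => by
    have h := hinv swapGL
    rw [ratGL, map_swapGL] at h
    rw [← swapGL_conj_upperGL]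
    exact mul_mem (mul_mem h (hu t)) h
  obtain ⟨t, ht⟩ := exists_isUnit_add_mul (x 0 0) (x 0 1) (x 1 0) (x 1 1)
    (by rw [← Matrix.det_fin_two, hx])
  exact mem_of_elementary_mem _ hu hl x hx t ht

omit [T1Space Z] in
theorem diagGL_mem_leftPeriods (hφ : Continuous φ) (hinv : ∀ γ, ratGL γ ∈ leftPeriods φ)
    {a : Adeleˣ} (ha : a ∈ principalIdeles) : diagGL a ∈ leftPeriods φ := by
  have h : principalIdeles ≤ (leftPeriods φ).comap diagGL := by
    refine sup_le ?_ ?_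
    · rintro r ⟨hr, hr'⟩
      -- The exponential parametrises `ℝ_+^*` by a path through 1, as `mem_leftPeriods_of_real`
      -- requires.
      let f : ℝ → Adeleˣ := fun s => ⟨(Real.exp s, 1), (Real.exp (-s), 1),
        Prod.ext (by simp [← Real.exp_add]) (one_mul _),
        Prod.ext (by simp [← Real.exp_add]) (one_mul _)⟩
      have hf : Continuous f := by
        refine Units.continuous_iff.2 ⟨?_, ?_⟩
        · exact (by fun_prop : Continuous fun s : ℝ => ((Real.exp s, 1) : Adele))
        · exact (by fun_prop : Continuous fun s : ℝ => ((Real.exp (-s), 1) : Adele))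
      have h := mem_leftPeriods_of_real hφ (f := fun s => diagGL (f s)) (continuous_diagGL.comp hf)
        (by
          have : f 0 = 1 := Units.ext (Prod.ext Real.exp_zero rfl)
          simp [this]) (Real.log (r : Adele).1)
      have e : f (Real.log (r : Adele).1) = r :=
        Units.ext (Prod.ext (Real.exp_log hr) hr'.symm)
      simpa [e] using h
    · rintro _ ⟨q, rfl⟩
      have h := hinv (diagGL q)
      rwa [ratGL, map_diagGL] at h
  exact h ha

/-- A continuous function on `GL_2(𝔸)` that is left invariant by `GL_2(ℚ)` and takes its values in
a totally disconnected space factors through the determinant and `𝔸^* → Ẑ^*`. -/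
theorem eq_diagGL_ideleProj_det (hφ : Continuous φ) (hinv : ∀ γ, ratGL γ ∈ leftPeriods φ)
    (x : GLA) : φ x = φ (diagGL (zHatUnits (ideleProj (GeneralLinearGroup.det x)))) := by
  set a : Adeleˣ := GeneralLinearGroup.det x with ha
  -- With `u = ideleProj a`, the matrix `x` is the product of an element of `SL_2(𝔸)`, the diagonal
  -- matrix of the principal idele `a u⁻¹`, and that of `u`; the first two are periods.
  have h1 : x * (diagGL a)⁻¹ ∈ leftPeriods φ := by
    refine mem_leftPeriods_of_det_eq_one hφ hinv _ ?_
    rw [← GeneralLinearGroup.val_det_apply, map_mul, map_inv, det_diagGL, ← ha, mul_inv_cancel]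
    rfl
  have h2 := diagGL_mem_leftPeriods hφ hinv (mul_zHatUnits_ideleProj_inv_mem a)
  have h3 := mul_mem h1 h2 (diagGL (zHatUnits (ideleProj a)))
  rw [← h3]
  congr 1
  rw [map_mul, map_inv]
  group

end Invariant

/-! ### Continuity of the projection of the ideles on `Ẑ^*` -/

section Projection

theorem ideleProj_apply {a : Adeleˣ} (h0 : 0 < (a : Adele).1)
    (h1 : ∀ ℓ : Nat.Primes, ‖(a : Adele).2 ℓ‖ = 1) (ℓ : Nat.Primes) :
    ((ideleProj a : ZHat) ℓ : ℚ_[ℓ]) = (a : Adele).2 ℓ := by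
  obtain ⟨u, hu⟩ := exists_zHatUnit a h1
  rw [← hu, ideleProj_eq (Subgroup.mem_sup_left (mul_zHatUnits_inv_mem_realPosIdeles h0 hu))]

theorem eventually_integral_idele :
    ∀ᶠ a : Adeleˣ in 𝓝 1, 0 < (a : Adele).1 ∧ ∀ ℓ : Nat.Primes, ‖(a : Adele).2 ℓ‖ = 1 := by
  have hO : IsOpen {x : FinAdele | ∀ ℓ : Nat.Primes, x ℓ ∈ (PadicInt.subring ℓ : Set ℚ_[ℓ])} :=
    RestrictedProduct.isOpen_forall_mem padicIntOpenFact.out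
  have h1 : ((1 : Adeleˣ) : Adele).2 ∈
      {x : FinAdele | ∀ ℓ : Nat.Primes, x ℓ ∈ (PadicInt.subring ℓ : Set ℚ_[ℓ])} :=
    fun ℓ => one_mem (PadicInt.subring ℓ)
  have hc : Continuous fun a : Adeleˣ => (a : Adele) := Units.continuous_val
  have e0 : ∀ᶠ a : Adeleˣ in 𝓝 1, 0 < (a : Adele).1 :=
    hc.fst.continuousAt.eventually (lt_mem_nhds one_pos)
  have e1 : ∀ᶠ a : Adeleˣ in 𝓝 1, ∀ ℓ : Nat.Primes,
      (a : Adele).2 ℓ ∈ (PadicInt.subring ℓ : Set ℚ_[ℓ]) :=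
    hc.snd.continuousAt.eventually (hO.mem_nhds h1)
  have e2 : ∀ᶠ a : Adeleˣ in 𝓝 1, ∀ ℓ : Nat.Primes,
      ((a⁻¹ : Adeleˣ) : Adele).2 ℓ ∈ (PadicInt.subring ℓ : Set ℚ_[ℓ]) :=
    (continuous_inv.tendsto' (1 : Adeleˣ) 1 inv_one).eventually e1
  filter_upwards [e0, e1, e2] with a h0 h1 h2
  refine ⟨h0, fun ℓ => le_antisymm (h1 ℓ) ?_⟩
  have h3 : ‖(a : Adele).2 ℓ‖ * ‖((a⁻¹ : Adeleˣ) : Adele).2 ℓ‖ = 1 := by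
    rw [← norm_mul]
    exact (congrArg norm (congrArg (compAt ℓ) a.mul_inv)).trans norm_one
  rw [← h3]
  exact mul_le_of_le_one_right (norm_nonneg _) (h2 ℓ)

/-- Near 1 an idele is positive at infinity and a unit at each prime, and there the projection
merely forgets the real component. Continuity at 1 suffices for a homomorphism. -/
theorem continuous_ideleProj : Continuous ideleProj := by
  have hval : Tendsto (fun a => (ideleProj a : ZHat)) (𝓝 1) (𝓝 1) := by
    refine tendsto_pi_nhds.2 fun ℓ => ?_
    refine (Topology.IsEmbedding.subtypeVal (p := fun x : ℚ_[ℓ] => ‖x‖ ≤ 1)).tendsto_nhds_iff.2 ?_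
    have hc : Continuous fun a : Adeleˣ => (a : Adele).2 ℓ :=
      (RestrictedProduct.continuous_eval ℓ).comp (continuous_snd.comp Units.continuous_val)
    have ht : Tendsto (fun a : Adeleˣ => (a : Adele).2 ℓ) (𝓝 1) (𝓝 1) := hc.tendsto 1
    refine ht.congr' ?_
    filter_upwards [eventually_integral_idele] with a ha
    exact (ideleProj_apply ha.1 ha.2 ℓ).symm
  refine continuous_of_continuousAt_one ideleProj ?_
  rw [Units.isInducing_embedProduct.continuousAt_iff]
  refine ContinuousAt.prodMk ?_ ?_
  · simpa [ContinuousAt] using hval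
  · refine MulOpposite.continuous_op.continuousAt.comp ?_
    have h : Tendsto (fun a : Adeleˣ => a⁻¹) (𝓝 1) (𝓝 1) := by
      simpa using (continuous_inv (G := Adeleˣ)).tendsto 1
    have := hval.comp h
    simpa [ContinuousAt, Function.comp_def] using this

/-- The projection of `GL_2(𝔸)` on `Ẑ^*`. -/
def detProj : GLA →* ZHatˣ := ideleProj.comp Matrix.GeneralLinearGroup.det

theorem continuous_detProj : Continuous detProj :=
  continuous_ideleProj.comp (Matrix.GeneralLinearGroup.continuous_det)

/-- The section `u ↦ (u 0; 0 1)` of the projection of `GL_2(𝔸)` on `Ẑ^*`. -/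
def diagZHat : ZHatˣ →* GLA := diagGL.comp zHatUnits

theorem continuous_diagZHat : Continuous diagZHat := by
  have h : Continuous (zHatAdele : ZHat → Adele) := continuous_const.prodMk continuous_zHatFin
  exact continuous_diagGL.comp (Continuous.units_map _ h)

theorem detProj_diagZHat (u : ZHatˣ) : detProj (diagZHat u) = u := by
  simp [detProj, diagZHat, det_diagGL, ideleProj_zHatUnits]

end Projection

/-! ### Pull-back of the classes of functions by homomorphisms -/

section Pullback

variable {H H' : Type} [Group H] [TopologicalSpace H] [Group H'] [TopologicalSpace H']
  {n n' : Type} [Fintype n] [DecidableEq n] [Fintype n'] [DecidableEq n']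
  {p : Nat.Primes} {L : Type} [NormedField L] [NormedAlgebra ℚ_[p] L]
  {D : H →* H'} {K₀ : Subgroup H} {K₀' : Subgroup H'}
  {π : H →* GL n ℚ_[p]} {π' : H' →* GL n' ℚ_[p]}

theorem IsLocSmooth.comp_monoidHom {L : Type} {f : H' → L} (hf : IsLocSmooth K₀' f)
    (hD : Continuous D) (hK : K₀ ≤ K₀'.comap D) : IsLocSmooth K₀ (f ∘ D) := by
  intro x
  obtain ⟨U, hU, K, hK', h⟩ := hf (D x)
  let d : K₀ →* K₀' := (D.comp K₀.subtype).codRestrict K₀' fun κ => hK κ.2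
  have hd : Continuous d := Continuous.subtype_mk (hD.comp continuous_subtype_val) _
  refine ⟨D ⁻¹' U, hD.continuousAt hU, K.comap d, hK'.preimage hd, fun y hy κ hκ => ?_⟩
  have := h (D y) hy (d κ) hκ
  rw [Function.comp_apply, Function.comp_apply, map_mul]
  exact this

/-- The map `G` describes `D` on `p`-components and must preserve algebraic and analytic functions.
It is only required near each point because the `p`-component of `detProj x` is not globally a
function of `x_p`: it also depends on the rational number that is divided out. -/
theorem funSpace_comp_monoidHom (hD : Continuous D) (hK : K₀ ≤ K₀'.comap D)
    (hG : ∀ x : H, ∃ G : GL n ℚ_[p] → GL n' ℚ_[p], (∀ᶠ y in 𝓝 x, π' (D y) = G (π y)) ∧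
      (∀ P ∈ algFun p L n', P ∘ G ∈ algFun p L n) ∧
      ∃ F : (n → n → ℚ_[p]) → (n' → n' → ℚ_[p]), AnalyticAt ℚ_[p] F (fun i j => π x i j) ∧
        ∀ g : GL n ℚ_[p], (fun i j => G g i j) = F (fun i j => g i j))
    {X : FunClass} {f : H' → L} (hf : f ∈ funSpace p L K₀' π' X) :
    f ∘ D ∈ funSpace p L K₀ π X := by
  cases X
  · exact Continuous.comp hf hD
  · exact ⟨hf.1.comp hD, hf.2.comp_monoidHom hD hK⟩
  · refine ⟨⟨hf.1.1.comp hD, hf.1.2.comp_monoidHom hD hK⟩, fun x => ?_⟩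
    obtain ⟨G, hG, -, F, hF, hGF⟩ := hG x
    obtain ⟨F', hF', h⟩ := hf.2 (D x)
    refine ⟨F' ∘ F, AnalyticAt.comp ?_ hF, ?_⟩
    · rwa [← hGF, ← hG.self_of_nhds]
    · filter_upwards [hG, hD.continuousAt.eventually h] with y hy hy'
      rw [Function.comp_apply, hy', hy, hGF]
      rfl
  · refine ⟨⟨hf.1.1.comp hD, hf.1.2.comp_monoidHom hD hK⟩, fun x => ?_⟩
    obtain ⟨G, hG, hP, -⟩ := hG x
    obtain ⟨P, hP', h⟩ := hf.2 (D x)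
    refine ⟨P ∘ G, hP P hP', ?_⟩
    filter_upwards [hG, hD.continuousAt.eventually h] with y hy hy'
    rw [Function.comp_apply, hy', hy]
    rfl
  · exact IsLocallyConstant.comp_continuous hf hD

end Pullback

/-! ### `H^0` -/

section HZero

open Matrix

variable {p : Nat.Primes} {L : Type} [NormedField L] [NormedAlgebra ℚ_[p] L]

/-- The scalar matrix of size one attached to an element of `ℚ_p^*`. -/
abbrev scalarGL (p : Nat.Primes) : ℚ_[p]ˣ →* GL (Fin 1) ℚ_[p] :=
  Units.map ((Matrix.scalar (Fin 1) : ℚ_[p] →+* Matrix (Fin 1) (Fin 1) ℚ_[p]) :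
    ℚ_[p] →* Matrix (Fin 1) (Fin 1) ℚ_[p])

theorem entry_mem_algFun {n : Type} [Fintype n] [DecidableEq n] (i j : n) :
    (fun g : GL n ℚ_[p] => algebraMap ℚ_[p] L (g i j)) ∈ algFun p L n :=
  Algebra.subset_adjoin (Or.inl ⟨(i, j), rfl⟩)

theorem invDet_mem_algFun {n : Type} [Fintype n] [DecidableEq n] :
    (fun g : GL n ℚ_[p] => algebraMap ℚ_[p] L ((g : Matrix n n ℚ_[p]).det)⁻¹) ∈ algFun p L n :=
  Algebra.subset_adjoin (Or.inr rfl)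

theorem analyticAt_entry {n : Type} [Fintype n] (i j : n) (x : n → n → ℚ_[p]) :
    AnalyticAt ℚ_[p] (fun M : n → n → ℚ_[p] => M i j) x :=
  ((ContinuousLinearMap.proj (R := ℚ_[p]) (φ := fun _ : n => ℚ_[p]) j).comp
    (ContinuousLinearMap.proj (R := ℚ_[p]) (φ := fun _ : n => n → ℚ_[p]) i)).analyticAt x

theorem algFun_comp_scalarGL_det {P : GL (Fin 1) ℚ_[p] → L} (hP : P ∈ algFun p L (Fin 1)) :
    (fun g : GL (Fin 2) ℚ_[p] => P (scalarGL p (GeneralLinearGroup.det g))) ∈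
      algFun p L (Fin 2) := by
  unfold algFun at hP
  induction hP using Algebra.adjoin_induction with
  | mem P hP =>
    rcases hP with ⟨⟨i, j⟩, rfl⟩ | rfl
    · have hent := entry_mem_algFun (p := p) (L := L) (n := Fin 2)
      convert sub_mem (mul_mem (hent 0 0) (hent 1 1)) (mul_mem (hent 0 1) (hent 1 0)) using 1
      funext g
      rw [Subsingleton.elim i j]
      simp [Matrix.det_fin_two]
    · have hdet := invDet_mem_algFun (p := p) (L := L) (n := Fin 2)
      convert hdet using 1
      funext g
      simp
  | algebraMap r => exact Subalgebra.algebraMap_mem _ r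
  | add P Q _ _ hP hQ => exact add_mem hP hQ
  | mul P Q _ _ hP hQ => exact mul_mem hP hQ

theorem algFun_comp_diagGL_det {P : GL (Fin 2) ℚ_[p] → L} (hP : P ∈ algFun p L (Fin 2)) :
    (fun g : GL (Fin 1) ℚ_[p] => P (diagGL (GeneralLinearGroup.det g))) ∈
      algFun p L (Fin 1) := by
  unfold algFun at hP
  induction hP using Algebra.adjoin_induction with
  | mem P hP =>
    rcases hP with ⟨⟨i, j⟩, rfl⟩ | rfl
    · have hent := entry_mem_algFun (p := p) (L := L) (0 : Fin 1) 0
      fin_cases i <;> fin_cases j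
      · convert hent using 1
        funext g
        simp [diagGL]
      · convert zero_mem (algFun p L (Fin 1)) using 1
        funext g
        simp [diagGL]
      · convert zero_mem (algFun p L (Fin 1)) using 1
        funext g
        simp [diagGL]
      · convert one_mem (algFun p L (Fin 1)) using 1
        funext g
        simp [diagGL]
    · have hdet := invDet_mem_algFun (p := p) (L := L) (n := Fin 1)
      convert hdet using 1
      funext g
      simp [diagGL]
  | algebraMap r => exact Subalgebra.algebraMap_mem _ r
  | add P Q _ _ hP hQ => exact add_mem hP hQ
  | mul P Q _ _ hP hQ => exact mul_mem hP hQ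

theorem det_compUnits (u : ZHatˣ) :
    (GeneralLinearGroup.det (compUnits p u) : ℚ_[p]) = ((u : ZHat) p : ℚ_[p]) := by
  simp [compUnits]
  rfl

theorem compGL_diagZHat (u : ZHatˣ) :
    compGL p (diagZHat u) = diagGL (GeneralLinearGroup.det (compUnits p u)) := by
  rw [diagZHat, MonoidHom.comp_apply, compGL, map_diagGL]
  congr 1
  refine Units.ext ?_
  rw [det_compUnits]
  rfl

theorem unitsAway_le_comap_diagZHat : unitsAway p ≤ (integralAwayGL p).comap diagZHat := by
  intro u hu
  have hu' : (u : ZHat) p = 1 := congrArg Units.val hu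
  refine ⟨⟨?_, ?_⟩, Subgroup.mem_iInf.2 fun ℓ => ?_⟩
  · change GeneralLinearGroup.map compInfty (diagGL (zHatUnits u)) = 1
    rw [map_diagGL]
    exact (congrArg diagGL (Units.ext rfl)).trans (map_one diagGL)
  · change compGL p (diagZHat u) = 1
    rw [compGL_diagZHat]
    refine (congrArg diagGL (Units.ext ?_)).trans (map_one diagGL)
    rw [det_compUnits, hu']
    rfl
  · refine ⟨diagGL (Units.map (Pi.evalMonoidHom (fun ℓ : Nat.Primes => ℤ_[ℓ]) ℓ) u), ?_⟩
    change _ = compGL ℓ (diagGL (zHatUnits u))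
    rw [map_diagGL, compGL, map_diagGL]
    exact congrArg diagGL (Units.ext rfl)

theorem comp_diagZHat_mem {X : FunClass} {φ : GLA → L} (hφ : φ ∈ adelicSpace p L X) :
    φ ∘ diagZHat ∈ unitsSpace p L X := by
  refine funSpace_comp_monoidHom continuous_diagZHat unitsAway_le_comap_diagZHat (fun u => ?_) hφ
  refine ⟨fun g => diagGL (GeneralLinearGroup.det g),
    Eventually.of_forall fun y => compGL_diagZHat y, fun P hP => algFun_comp_diagGL_det hP,
    fun M => !![M 0 0, 0; 0, 1], ?_, fun g => ?_⟩
  · refine AnalyticAt.pi fun i => AnalyticAt.pi fun j => ?_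
    fin_cases i <;> fin_cases j
    exacts [analyticAt_entry 0 0 _, analyticAt_const, analyticAt_const, analyticAt_const]
  · funext i j
    fin_cases i <;> fin_cases j <;> simp [diagGL]

theorem norm_det_eq_one {ℓ : Nat.Primes} {g : GL (Fin 2) ℚ_[ℓ]}
    (hg : g ∈ (GeneralLinearGroup.map (n := Fin 2) (PadicInt.Coe.ringHom (p := ℓ))).range) :
    ‖(GeneralLinearGroup.det g : ℚ_[ℓ])‖ = 1 := by
  obtain ⟨M, rfl⟩ := hg
  rw [GeneralLinearGroup.map_det]
  exact PadicInt.isUnit_iff.1 (GeneralLinearGroup.det M).isUnit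

/-- The determinant of such an element is 1 at infinity and a unit at every prime, so the projection
does not change its `p`-component, which is 1. -/
theorem integralAwayGL_le_comap_detProj : integralAwayGL p ≤ (unitsAway p).comap detProj := by
  intro κ hκ
  set a : Adeleˣ := GeneralLinearGroup.det κ with ha
  have h0 : (a : Adele).1 = 1 := by
    have h := GeneralLinearGroup.map_det compInfty κ
    rw [hκ.1.1, map_one] at h
    exact (congrArg Units.val h).symm
  have hp : (a : Adele).2 p = 1 := by
    have h := GeneralLinearGroup.map_det (compAt p) κ
    have h' : GeneralLinearGroup.map (compAt p) κ = 1 := hκ.1.2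
    rw [h', map_one] at h
    exact (congrArg Units.val h).symm
  have hℓ : ∀ ℓ : Nat.Primes, ‖(a : Adele).2 ℓ‖ = 1 := fun ℓ => by
    have h := GeneralLinearGroup.map_det (compAt ℓ) κ
    have h' := norm_det_eq_one (Subgroup.mem_iInf.1 hκ.2 ℓ)
    rw [compGL, h] at h'
    exact h'
  refine Units.ext (Subtype.ext ?_)
  exact (ideleProj_apply (h0 ▸ one_pos) hℓ p).trans hp

/-- For `y` near `x` the idele `det (x⁻¹ y)` is integral and positive, so its projection has the
same `p`-component as itself; multiplicativity supplies the constant factor. -/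
theorem eventually_compUnits_detProj (x : GLA) :
    ∀ᶠ y in 𝓝 x, compUnits p (detProj y) =
      compUnits p (detProj x) * (scalarGL p (GeneralLinearGroup.det (compGL p x)))⁻¹ *
        scalarGL p (GeneralLinearGroup.det (compGL p y)) := by
  have hc : Continuous fun y : GLA => (GeneralLinearGroup.det (x⁻¹ * y) : Adeleˣ) :=
    GeneralLinearGroup.continuous_det.comp (continuous_const_mul _)
  filter_upwards [(hc.tendsto' x 1 (by simp)).eventually eventually_integral_idele] with y hy
  set b : Adeleˣ := GeneralLinearGroup.det (x⁻¹ * y) with hb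
  have h1 : compUnits p (ideleProj b) = scalarGL p (ideleAt p b) :=
    Units.ext (congrArg (Matrix.scalar (Fin 1)) (ideleProj_apply hy.1 hy.2 p))
  have h2 : detProj y = detProj x * ideleProj b := by
    rw [hb, ← mul_inv_cancel_left x y, map_mul detProj]
    simp [detProj]
  have h3 : ideleAt p b = (GeneralLinearGroup.det (compGL p x))⁻¹ *
      GeneralLinearGroup.det (compGL p y) := by
    rw [compGL, GeneralLinearGroup.map_det, GeneralLinearGroup.map_det, ← map_inv, ← map_mul,
      hb, map_mul, map_inv]
  rw [h2, map_mul, h1, h3, map_mul, map_inv, mul_assoc]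

theorem comp_detProj_mem {X : FunClass} {f : ZHatˣ → L} (hf : f ∈ unitsSpace p L X) :
    f ∘ detProj ∈ adelicSpace p L X := by
  refine funSpace_comp_monoidHom continuous_detProj integralAwayGL_le_comap_detProj
    (fun x => ?_) hf
  let k : GL (Fin 1) ℚ_[p] :=
    compUnits p (detProj x) * (scalarGL p (GeneralLinearGroup.det (compGL p x)))⁻¹
  refine ⟨fun g => k * scalarGL p (GeneralLinearGroup.det g), eventually_compUnits_detProj x,
    fun P hP => ?_, fun M _ _ => k 0 0 * (M 0 0 * M 1 1 - M 0 1 * M 1 0), ?_, fun g => ?_⟩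
  · have h := algFun_comp_scalarGL_det (algFun_translate hP k 1)
    simp only [mul_one] at h
    exact h
  · refine AnalyticAt.pi fun i => AnalyticAt.pi fun j => ?_
    exact analyticAt_const.mul (((analyticAt_entry 0 0 _).mul (analyticAt_entry 1 1 _)).sub
      ((analyticAt_entry 0 1 _).mul (analyticAt_entry 1 0 _)))
  · funext i j
    rw [Subsingleton.elim i 0, Subsingleton.elim j 0]
    simp [Matrix.mul_apply, Matrix.det_fin_two]

theorem totallyDisconnectedSpace_of_padic [FiniteDimensional ℚ_[p] L] :
    TotallyDisconnectedSpace L := by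
  let e : L ≃L[ℚ_[p]] (Fin (Module.finrank ℚ_[p] L) → ℚ_[p]) :=
    ContinuousLinearEquiv.ofFinrankEq (by simp)
  exact e.symm.toHomeomorph.totallyDisconnectedSpace

theorem ratGL_mem_leftPeriods {X : FunClass} (φ : (adelicRho p L X).invariants) (γ : GLQ) :
    ratGL γ ∈ leftPeriods ((φ : adelicSpace p L X) : GLA → L) := by
  intro y
  have h := congrFun (congrArg Subtype.val (φ.2 γ⁻¹)) y
  have h' : ((φ : adelicSpace p L X) : GLA → L) ((ratGL γ⁻¹)⁻¹ * y) =
    ((φ : adelicSpace p L X) : GLA → L) y := h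
  rwa [map_inv, inv_inv] at h'

theorem continuous_of_mem_adelicSpace {X : FunClass} {φ : GLA → L} (hφ : φ ∈ adelicSpace p L X) :
    Continuous φ := by
  cases X
  · exact hφ
  · exact hφ.1
  · exact hφ.1.1
  · exact hφ.1.1
  · exact IsLocallyConstant.continuous hφ

theorem invariants_apply [FiniteDimensional ℚ_[p] L] {X : FunClass}
    (φ : (adelicRho p L X).invariants) (x : GLA) :
    ((φ : adelicSpace p L X) : GLA → L) x =
      ((φ : adelicSpace p L X) : GLA → L) (diagZHat (detProj x)) := by
  have := totallyDisconnectedSpace_of_padic (p := p) (L := L)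
  exact eq_diagGL_ideleProj_det (continuous_of_mem_adelicSpace φ.1.2) (ratGL_mem_leftPeriods φ) x

theorem detProj_ratGL (γ : GLQ) : detProj (ratGL γ) = 1 := by
  have h : (GeneralLinearGroup.det (ratGL γ) : Adeleˣ) ∈ ideleProj.ker := by
    rw [ker_ideleProj, ratGL, GeneralLinearGroup.map_det]
    exact Subgroup.mem_sup_right ⟨_, rfl⟩
  exact h

variable (p L) in
/-- The invariant functions on `GL_2(𝔸)` are the functions on `Ẑ^*`. -/
def invariantsEquiv [FiniteDimensional ℚ_[p] L] (X : FunClass) :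
    (adelicRho p L X).invariants ≃ₗ[L] unitsSpace p L X where
  toFun φ := ⟨((φ : adelicSpace p L X) : GLA → L) ∘ diagZHat, comp_diagZHat_mem φ.1.2⟩
  map_add' _ _ := rfl
  map_smul' _ _ := rfl
  invFun f := ⟨⟨(f : ZHatˣ → L) ∘ detProj, comp_detProj_mem f.2⟩, fun γ => by
    refine Subtype.ext (funext fun x => ?_)
    change (f : ZHatˣ → L) (detProj ((ratGL γ)⁻¹ * x)) = (f : ZHatˣ → L) (detProj x)
    rw [map_mul, map_inv, detProj_ratGL, inv_one, one_mul]⟩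
  left_inv φ := Subtype.ext (Subtype.ext (funext fun x => (invariants_apply φ x).symm))
  right_inv f := Subtype.ext (funext fun u => congrArg (f : ZHatˣ → L) (detProj_diagZHat u))

variable (p L) in
/-- The isomorphism `H^0(GL_2(ℚ), X(GL_2(𝔸))) ≅ X(Ẑ^*)`. -/
def adelicCohomologyZeroEquiv [FiniteDimensional ℚ_[p] L] (X : FunClass) :
    adelicCohomology p L X 0 ≃ₗ[L] unitsSpace p L X :=
  (groupCohomology.H0Iso (adelicRep p L X)).toLinearEquiv.trans (invariantsEquiv p L X)

/-- The translated function takes at `diagZHat u` the value of `φ` at `diagZHat u * g`, and `φ` only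
depends on `detProj`. -/
theorem adelicCohomologyZeroEquiv_action [FiniteDimensional ℚ_[p] L] (X : FunClass) (g : GLA)
    (ξ : adelicCohomology p L X 0) (u : ZHatˣ) :
    (adelicCohomologyZeroEquiv p L X (adelicAction p L X 0 g ξ) : ZHatˣ → L) u =
      (adelicCohomologyZeroEquiv p L X ξ : ZHatˣ → L) (u * detProj g) := by
  let φ : (adelicRho p L X).invariants := (groupCohomology.H0Iso (adelicRep p L X)).hom ξ
  have h : (adelicCohomologyZeroEquiv p L X (adelicAction p L X 0 g ξ) : ZHatˣ → L) u =
      ((φ : adelicSpace p L X) : GLA → L) (diagZHat u * g) := by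
    have h1 := groupCohomology.map_id_comp_H0Iso_hom_apply (rightTranslation p L X g) ξ
    exact congrArg (fun ψ : (adelicRho p L X).invariants =>
      ((ψ : adelicSpace p L X) : GLA → L) (diagZHat u)) h1
  rw [h, invariants_apply, map_mul, detProj_diagZHat]
  rfl

end HZero

/-! ### Vanishing in degrees at least two -/

section Local

variable {H : Type} [Group H] [TopologicalSpace H] {n : Type} [Fintype n] [DecidableEq n]
  {p : Nat.Primes} {L : Type} [NormedField L] [NormedAlgebra ℚ_[p] L]

/-- The classes of functions are local for the open sets that are stable by `K₀`. -/
theorem mem_funSpace_of_local {K₀ : Subgroup H} {π : H →* GL n ℚ_[p]} {X : FunClass} {φ : H → L}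
    (h : ∀ x, ∃ ψ ∈ funSpace p L K₀ π X, ∃ O : Set H, IsOpen O ∧ x ∈ O ∧
      (∀ y ∈ O, ∀ κ ∈ K₀, y * κ ∈ O) ∧ ∀ y ∈ O, φ y = ψ y) :
    φ ∈ funSpace p L K₀ π X := by
  have hev : ∀ x, ∃ ψ ∈ funSpace p L K₀ π X, φ =ᶠ[𝓝 x] ψ := fun x => by
    obtain ⟨ψ, hψ, O, hO, hx, -, h'⟩ := h x
    exact ⟨ψ, hψ, Filter.eventually_of_mem (hO.mem_nhds hx) h'⟩
  have hcont : (∀ ψ ∈ funSpace p L K₀ π X, Continuous ψ) → Continuous φ := fun hc =>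
    continuous_iff_continuousAt.2 fun x => by
      obtain ⟨ψ, hψ, h'⟩ := hev x
      exact (hc ψ hψ).continuousAt.congr h'.symm
  have hsmooth : (∀ ψ ∈ funSpace p L K₀ π X, IsLocSmooth K₀ ψ) → IsLocSmooth K₀ φ := fun hs x => by
    obtain ⟨ψ, hψ, O, hO, hx, hOK, h'⟩ := h x
    obtain ⟨U, hU, K, hK, hUK⟩ := hs ψ hψ x
    -- Smoothness compares `y` with `y κ`, where `κ` need not be close to 1; stability of `O` by
    -- `K₀` ensures that `φ = ψ` at both points.
    refine ⟨U ∩ O, inter_mem hU (hO.mem_nhds hx), K, hK, fun y hy κ hκ => ?_⟩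
    rw [h' y hy.2, h' _ (hOK y hy.2 κ κ.2), hUK y hy.1 κ hκ]
  cases X
  · exact hcont fun ψ hψ => hψ
  · exact ⟨hcont fun ψ hψ => hψ.1, hsmooth fun ψ hψ => hψ.2⟩
  · refine ⟨⟨hcont fun ψ hψ => hψ.1.1, hsmooth fun ψ hψ => hψ.1.2⟩, fun x => ?_⟩
    obtain ⟨ψ, hψ, h'⟩ := hev x
    obtain ⟨F, hF, hF'⟩ := hψ.2 x
    exact ⟨F, hF, h'.trans hF'⟩
  · refine ⟨⟨hcont fun ψ hψ => hψ.1.1, hsmooth fun ψ hψ => hψ.1.2⟩, fun x => ?_⟩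
    obtain ⟨ψ, hψ, h'⟩ := hev x
    obtain ⟨P, hP, hP'⟩ := hψ.2 x
    exact ⟨P, hP, h'.trans hP'⟩
  · refine (IsLocallyConstant.iff_eventually_eq φ).2 fun x => ?_
    obtain ⟨ψ, hψ, h'⟩ := hev x
    filter_upwards [h', IsLocallyConstant.eventually_eq hψ x] with y hy hy'
    rw [hy, hy', h'.self_of_nhds]

end Local

/-! ### Strong approximation and the arithmetic subgroup `SL_2(ℤ)` -/

section Integral

open Matrix MatrixGroups

/-- The open subgroup `GL_2(ℝ)_+ × GL_2(Ẑ)` of `GL_2(𝔸)`. -/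
def integralGL : Subgroup GLA :=
  (GLPos (Fin 2) ℝ).comap (GeneralLinearGroup.map (n := Fin 2) compInfty) ⊓
    ⨅ ℓ : Nat.Primes,
      (GeneralLinearGroup.map (n := Fin 2) (PadicInt.Coe.ringHom (p := ℓ))).range.comap (compGL ℓ)

theorem mem_integralGL {x : GLA} : x ∈ integralGL ↔
    0 < ((GeneralLinearGroup.det x : Adeleˣ) : Adele).1 ∧ ∀ ℓ : Nat.Primes,
      compGL ℓ x ∈ (GeneralLinearGroup.map (n := Fin 2) (PadicInt.Coe.ringHom (p := ℓ))).range := by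
  have h : GeneralLinearGroup.map compInfty x ∈ GLPos (Fin 2) ℝ ↔
      0 < ((GeneralLinearGroup.det x : Adeleˣ) : Adele).1 := by
    rw [mem_glpos, GeneralLinearGroup.map_det]
    rfl
  rw [integralGL, Subgroup.mem_inf, Subgroup.mem_iInf, ← h]
  rfl

theorem integralAwayGL_le_integralGL (p : Nat.Primes) : integralAwayGL p ≤ integralGL := by
  intro κ hκ
  refine ⟨?_, hκ.2⟩
  have h : GeneralLinearGroup.map compInfty κ = 1 := hκ.1.1
  change GeneralLinearGroup.map compInfty κ ∈ GLPos (Fin 2) ℝ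
  rw [h]
  exact one_mem _

theorem isOpen_integralGL : IsOpen (integralGL : Set GLA) := by
  refine Subgroup.isOpen_of_mem_nhds integralGL (g := 1) ?_
  have hO : IsOpen {x : FinAdele | ∀ ℓ : Nat.Primes, x ℓ ∈ (PadicInt.subring ℓ : Set ℚ_[ℓ])} :=
    RestrictedProduct.isOpen_forall_mem padicIntOpenFact.out
  have h1 : ∀ i j, ((1 : GLA) i j).2 ∈
      {x : FinAdele | ∀ ℓ : Nat.Primes, x ℓ ∈ (PadicInt.subring ℓ : Set ℚ_[ℓ])} := by
    intro i j ℓ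
    by_cases hij : i = j
    · subst hij
      simp
    · simp [Matrix.one_apply_ne hij]
  have hc : ∀ i j, Continuous fun g : GLA => (g i j).2 := fun i j => by
    have h : Continuous fun g : GLA => (g : Matrix (Fin 2) (Fin 2) Adele) := Units.continuous_val
    exact continuous_snd.comp (h.matrix_elem i j)
  have e1 : ∀ i j, ∀ᶠ g : GLA in 𝓝 1, (g i j).2 ∈
      {x : FinAdele | ∀ ℓ : Nat.Primes, x ℓ ∈ (PadicInt.subring ℓ : Set ℚ_[ℓ])} := fun i j =>
    (hc i j).continuousAt.eventually (hO.mem_nhds (h1 i j))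
  have e2 := fun i j => (continuous_inv.tendsto' (1 : GLA) 1 inv_one).eventually (e1 i j)
  have hdet : Continuous fun g : GLA => ((GeneralLinearGroup.det g : Adeleˣ) : Adele).1 :=
    continuous_fst.comp (Units.continuous_val.comp GeneralLinearGroup.continuous_det)
  have e0 : ∀ᶠ g : GLA in 𝓝 1, 0 < ((GeneralLinearGroup.det g : Adeleˣ) : Adele).1 :=
    (hdet.tendsto' 1 1 (by rw [map_one]; rfl)).eventually (lt_mem_nhds one_pos)
  filter_upwards [e0, eventually_all.2 fun i => eventually_all.2 (e1 i),
    eventually_all.2 fun i => eventually_all.2 (e2 i)] with g k0 k1 k2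
  refine mem_integralGL.2 ⟨k0, fun ℓ => ?_⟩
  · refine mem_range_padicInt _ (fun i j => k1 i j ℓ) (fun i j => ?_)
    rw [← map_inv]
    exact k2 i j ℓ

theorem diagZHat_mem_integralGL (u : ZHatˣ) : diagZHat u ∈ integralGL := by
  refine mem_integralGL.2 ⟨?_, fun ℓ => ?_⟩
  · rw [diagZHat, MonoidHom.comp_apply, det_diagGL]
    exact one_pos
  · refine ⟨diagGL (Units.map (Pi.evalMonoidHom (fun ℓ : Nat.Primes => ℤ_[ℓ]) ℓ) u), ?_⟩
    change _ = compGL ℓ (diagGL (zHatUnits u))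
    rw [map_diagGL, compGL, map_diagGL]
    exact congrArg diagGL (Units.ext rfl)

/-- Strong approximation: `GL_2(𝔸) = GL_2(ℚ) (GL_2(ℝ)_+ × GL_2(Ẑ))`. -/
theorem exists_ratGL_mul_mem (x : GLA) : ∃ γ : GLQ, ratGL γ * x ∈ integralGL := by
  -- `W` is a union of left cosets of the open subgroup `integralGL`, hence clopen, and it is stable
  -- by `GL_2(ℚ)`. Its indicator is therefore determined by its values at the matrices `diagZHat u`,
  -- which lie in `integralGL`.
  let W : Set GLA := {x | ∃ γ : GLQ, ratGL γ * x ∈ integralGL}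
  have hW : ∀ x : GLA, {y | x⁻¹ * y ∈ integralGL} ∈ 𝓝 x := fun x =>
    (isOpen_integralGL.preimage (continuous_const_mul x⁻¹)).mem_nhds (by simp [one_mem])
  have hWU : ∀ x y : GLA, x⁻¹ * y ∈ integralGL → (x ∈ W ↔ y ∈ W) := fun x y h => by
    refine exists_congr fun γ => ?_
    have e : ratGL γ * y = ratGL γ * x * (x⁻¹ * y) := by group
    rw [e]
    exact (integralGL.mul_mem_cancel_right h).symm
  have hclopen : IsClopen W := by
    refine ⟨isOpen_compl_iff.1 (isOpen_iff_mem_nhds.2 fun x hx => ?_),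
      isOpen_iff_mem_nhds.2 fun x hx => ?_⟩
    · exact mem_of_superset (hW x) fun y hy hy' => hx ((hWU x y hy).2 hy')
    · exact mem_of_superset (hW x) fun y hy => (hWU x y hy).1 hx
  have hcont := (continuous_boolIndicator_iff_isClopen W).2 hclopen
  have hinv : ∀ γ, ratGL γ ∈ leftPeriods W.boolIndicator := by
    intro γ y
    have h : ratGL γ * y ∈ W ↔ y ∈ W := by
      refine ⟨fun ⟨δ, h⟩ => ⟨δ * γ, by rwa [map_mul, mul_assoc]⟩,
        fun ⟨δ, h⟩ => ⟨δ * γ⁻¹, by rwa [map_mul, map_inv, mul_assoc, inv_mul_cancel_left]⟩⟩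
    rw [Bool.eq_iff_iff, ← Set.mem_iff_boolIndicator, ← Set.mem_iff_boolIndicator, h]
  have h := eq_diagGL_ideleProj_det hcont hinv x
  refine (Set.mem_iff_boolIndicator W x).2 (h.trans ((Set.mem_iff_boolIndicator W _).1 ?_))
  exact ⟨1, by rw [map_one, one_mul]; exact diagZHat_mem_integralGL _⟩

/-- The subgroup of the rational matrices that belong to `integralGL`: it is `SL_2(ℤ)`. -/
abbrev integralRatGL : Subgroup GLQ := integralGL.comap ratGL

theorem mapGL_mem_integralRatGL (g : SL(2, ℤ)) :
    SpecialLinearGroup.mapGL ℚ g ∈ integralRatGL := by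
  refine mem_integralGL.2 ⟨?_, fun ℓ => ?_⟩
  · rw [ratGL, GeneralLinearGroup.map_det, SpecialLinearGroup.det_mapGL, map_one]
    exact one_pos
  · refine ⟨SpecialLinearGroup.mapGL ℤ_[ℓ] g, ?_⟩
    ext i j
    change ((algebraMap ℤ ℤ_[ℓ] (g i j) : ℤ_[ℓ]) : ℚ_[ℓ]) = ((algebraMap ℤ ℚ (g i j) : ℚ) : ℚ_[ℓ])
    simp

/-- The determinant is a positive rational number and a unit at all primes, hence 1; the entries are
integral at all primes, hence integers. -/
theorem exists_mapGL_eq {γ : GLQ} (hγ : γ ∈ integralRatGL) :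
    ∃ g : SL(2, ℤ), SpecialLinearGroup.mapGL ℚ g = γ := by
  have ⟨hpos, hℓ⟩ := mem_integralGL.1 hγ
  have hdet : (γ : Matrix (Fin 2) (Fin 2) ℚ).det = 1 := by
    refine rat_eq_one ?_ fun ℓ => ?_
    · rw [ratGL, GeneralLinearGroup.map_det] at hpos
      have h' : (0 : ℝ) < ((γ : Matrix (Fin 2) (Fin 2) ℚ).det : ℝ) := hpos
      exact_mod_cast h'
    · have h := norm_det_eq_one (hℓ ℓ)
      rw [compGL, ratGL, GeneralLinearGroup.map_det, GeneralLinearGroup.map_det] at h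
      exact h
  have hent : ∀ i j, ∃ m : ℤ, (m : ℚ) = γ i j := fun i j =>
    isInt_of_padic_norm_le_one fun ℓ => by
      obtain ⟨M, hM⟩ := hℓ ℓ
      have h : ((M i j : ℤ_[ℓ]) : ℚ_[ℓ]) = ((γ i j : ℚ) : ℚ_[ℓ]) :=
        congrArg (fun A : GL (Fin 2) ℚ_[ℓ] => A i j) hM
      rw [← h]
      exact (M i j).2
  choose m hm using hent
  have hmap : (Matrix.of m).map (Int.cast : ℤ → ℚ) = γ := by
    ext i j
    exact hm i j
  refine ⟨⟨Matrix.of m, ?_⟩, ?_⟩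
  · have h := Int.cast_det (R := ℚ) (Matrix.of m)
    rw [hmap, hdet] at h
    exact_mod_cast h
  · ext i j
    exact hm i j

/-- The isomorphism of `SL_2(ℤ)` with the group of rational matrices in `integralGL`. -/
def toIntegralRatGL : SL(2, ℤ) →* integralRatGL :=
  (SpecialLinearGroup.mapGL ℚ).codRestrict _ mapGL_mem_integralRatGL

theorem exists_isFreeGroup_finiteIndex :
    ∃ S : Subgroup integralRatGL, S.FiniteIndex ∧ IsFreeGroup S := by
  have hinj : Function.Injective toIntegralRatGL := fun g h e =>
    SpecialLinearGroup.mapGL_injective (congrArg Subtype.val e)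
  have hsurj : Function.Surjective toIntegralRatGL := fun γ => by
    obtain ⟨g, hg⟩ := exists_mapGL_eq γ.2
    exact ⟨g, Subtype.ext hg⟩
  let ψ : FreeGroup Bool →* integralRatGL := toIntegralRatGL.comp (FreeGroup.lift sanovGen)
  have hψ : Function.Injective ψ := hinj.comp lift_sanovGen_injective
  refine ⟨ψ.range, ?_, IsFreeGroup.ofMulEquiv (MonoidHom.ofInjective hψ)⟩
  have h := range_lift_sanovGen_finiteIndex
  rw [MonoidHom.range_comp]
  -- Under a surjection the index of the image divides the original index, which is not zero.
  refine ⟨fun h0 => h.index_ne_zero ?_⟩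
  have hdvd := Subgroup.index_map_dvd (FreeGroup.lift sanovGen).range hsurj
  rwa [h0, zero_dvd_iff] at hdvd

end Integral

/-! ### `X(GL_2(𝔸))` as a direct factor of a coinduced representation -/

section Retract

open CategoryTheory Limits

variable (p : Nat.Primes) (L : Type) [NormedField L] [NormedAlgebra ℚ_[p] L] (X : FunClass)

/-- The representation of `GL_2(ℚ)` coinduced from the restriction of `X(GL_2(𝔸))` to `SL_2(ℤ)`. -/
abbrev adelicCoind : Rep L GLQ :=
  Rep.coind integralRatGL.subtype (Rep.res integralRatGL.subtype (adelicRep p L X))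

variable {p L X}

/-- The value at `g` of an element of `adelicCoind`, as a function on `GL_2(𝔸)`. -/
def adelicCoindFun (f : adelicCoind p L X) (g : GLQ) : GLA → L :=
  ((f.1 g : adelicSpace p L X) : GLA → L)

/-- The function on `GL_2(𝔸)` that is obtained by gluing the functions `x ↦ f(g)(g x)` on the
translates of `integralGL`. -/
def glue (f : adelicCoind p L X) (x : GLA) : L :=
  adelicCoindFun f (exists_ratGL_mul_mem x).choose (ratGL (exists_ratGL_mul_mem x).choose * x)

/-- Two choices of `g` differ by an element `s` of `integralRatGL`, and the relation `f(s g) = s *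
f(g)` shows that the value at `x` is the same. -/
theorem glue_eq (f : adelicCoind p L X) {x : GLA} {g : GLQ} (hg : ratGL g * x ∈ integralGL) :
    glue f x = adelicCoindFun f g (ratGL g * x) := by
  rw [glue]
  set g' := (exists_ratGL_mul_mem x).choose
  have hg' : ratGL g' * x ∈ integralGL := (exists_ratGL_mul_mem x).choose_spec
  have hs : g' * g⁻¹ ∈ integralRatGL := by
    have h := mul_mem hg' (inv_mem hg)
    have e : ratGL g' * x * (ratGL g * x)⁻¹ = ratGL (g' * g⁻¹) := by
      rw [map_mul, map_inv]
      group
    rwa [e] at h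
  have h : f.1 ((⟨g' * g⁻¹, hs⟩ : integralRatGL) * g) = adelicRho p L X (g' * g⁻¹) (f.1 g) :=
    f.2 ⟨g' * g⁻¹, hs⟩ g
  rw [inv_mul_cancel_right] at h
  have h' := congrFun (congrArg Subtype.val h) (ratGL g' * x)
  refine h'.trans ?_
  change adelicCoindFun f g ((ratGL (g' * g⁻¹))⁻¹ * (ratGL g' * x)) = _
  congr 1
  rw [map_mul, map_inv]
  group

theorem glue_mem (f : adelicCoind p L X) : glue f ∈ adelicSpace p L X := by
  refine mem_funSpace_of_local fun x => ?_
  obtain ⟨g, hg⟩ := exists_ratGL_mul_mem x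
  refine ⟨_, (adelicRho p L X g⁻¹ (f.1 g) : adelicSpace p L X).2,
    {y | ratGL g * y ∈ integralGL}, isOpen_integralGL.preimage (continuous_const_mul _), hg,
    fun y hy κ hκ => ?_, fun y hy => ?_⟩
  · rw [Set.mem_ofPred_eq, ← mul_assoc]
    exact mul_mem hy (integralAwayGL_le_integralGL p hκ)
  · rw [glue_eq f hy]
    change adelicCoindFun f g _ = adelicCoindFun f g ((ratGL g⁻¹)⁻¹ * y)
    rw [map_inv, inv_inv]

variable (p L X)

/-- The retraction of `adelicCoind` on `X(GL_2(𝔸))`. -/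
def glueHom : adelicCoind p L X ⟶ adelicRep p L X :=
  Rep.ofHom
    { toFun := fun f => ⟨glue f, glue_mem f⟩
      map_add' := fun _ _ => rfl
      map_smul' := fun _ _ => rfl
      isIntertwining' := fun h => by
        ext f x
        obtain ⟨g, hg⟩ := exists_ratGL_mul_mem x
        change glue ((adelicCoind p L X).ρ h f) x = glue f ((ratGL h)⁻¹ * x)
        have hg' : ratGL (g * h) * ((ratGL h)⁻¹ * x) ∈ integralGL := by
          rwa [map_mul, mul_assoc, mul_inv_cancel_left]
        rw [glue_eq _ hg, glue_eq _ hg', map_mul, mul_assoc, mul_inv_cancel_left]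
        rfl }

/-- The function attached to `φ` sends `g` to the translate `g * φ`, whose value at `g x` is `φ(x)`:
each glued piece is `φ` itself. -/
theorem coindUnit_comp_glueHom :
    coindUnit integralRatGL (adelicRep p L X) ≫ glueHom p L X = 𝟙 _ := by
  ext φ x
  obtain ⟨g, hg⟩ := exists_ratGL_mul_mem x
  change glue ((coindUnit integralRatGL (adelicRep p L X)).hom φ) x = (φ : GLA → L) x
  rw [glue_eq _ hg]
  change (φ : GLA → L) ((ratGL g)⁻¹ * (ratGL g * x)) = (φ : GLA → L) x
  rw [inv_mul_cancel_left]

/-- Two retractions and Shapiro's lemma lead from `GL_2(ℚ)` to `SL_2(ℤ)` and then to a free group;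
`L` has characteristic zero because it contains `ℚ_p`. -/
theorem isZero_adelicCohomology (n : ℕ) : IsZero (adelicCohomology p L X (n + 2)) := by
  obtain ⟨S, hS, hS'⟩ := exists_isFreeGroup_finiteIndex
  have : CharZero L := charZero_of_injective_algebraMap (algebraMap ℚ_[p] L).injective
  refine isZero_groupCohomology_of_retract _ _ (coindUnit_comp_glueHom p L X) ?_
  exact (isZero_groupCohomology_of_finiteIndex_isFreeGroup S _ n).of_iso
    (groupCohomology.coindIso _ _)

end Retract

end

theorem mainTheorem1 (p : Nat.Primes) (L : Type) [NormedField L] [NormedAlgebra ℚ_[p] L]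
    [FiniteDimensional ℚ_[p] L] :
    ∃ c : Adeleˣ →* ZHatˣ,
      (∀ u : ZHatˣ, c (zHatUnits u) = u) ∧ c.ker = realPosIdeles ⊔ ratIdeles ∧
      ∀ X : FunClass,
        (∃ e : adelicCohomology p L X 0 ≃ₗ[L] unitsSpace p L X,
          ∀ (g : GLA) (ξ : adelicCohomology p L X 0) (u : ZHatˣ),
            (e (adelicAction p L X 0 g ξ) : ZHatˣ → L) u =
              (e ξ : ZHatˣ → L) (u * c (Matrix.GeneralLinearGroup.det g))) ∧
        ∀ i : ℕ, 2 ≤ i → Subsingleton (adelicCohomology p L X i) := by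
  refine ⟨ideleProj, ideleProj_zHatUnits, ker_ideleProj, fun X => ⟨⟨adelicCohomologyZeroEquiv p L X,
    fun g ξ u => adelicCohomologyZeroEquiv_action X g ξ u⟩, fun i hi => ?_⟩⟩
  obtain ⟨n, rfl⟩ := Nat.exists_eq_add_of_le' hi
  exact ModuleCat.subsingleton_of_isZero (isZero_adelicCohomology p L X n)
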